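/- **Conventions.** Games are thin concurrent games in the sense of Castellan, Clairambault and Winskel: event structures $A$ with polarities and (finite) configurations $\mathscr{C}(A)$, equipped with isomorphism families $\cong_A^{+},\cong_A^{-}\,\subseteq\,\cong_A$ of polarity-preserving bijections between configurations (the positive symmetries, the negative symmetries, and all symmetries), such that a symmetry that is both positive and negative is an identity, an extension in $\cong_A$ of a positive symmetry by positive events is positive, and an extension in $\cong_A$ of a negative symmetry by negative events is negative. Write $\theta : x\cong_A y$ when $\theta$ is a symmetry from $x$ to $y$. A symmetry class is an equivalence class of configurations under $\cong_A$; fix, for each of the games $A,B,C$ below, an arbitrary choice of a representative $\underline{\mathsf x}\in\mathsf x$ of every symmetry class $\mathsf x$, and let $\mathrm{Sym}(\mathsf x)$ be the set of all $\theta:\underline{\mathsf x}\cong\underline{\mathsf x}$. A strategy $\sigma : A\stackrel{S}{\to}B$ is a map $\sigma:S\to A^\perp\parallel B$ of event structures with symmetry and polarities which is receptive, courteous and $\sim$-receptive, with $S$ thin. For $x^S\in\mathscr C(S)$ write $\sigma x^S=x^S_A\parallel x^S_B$. A configuration of $S$ is $+$-covered if all its maximal events are positive. Let $$\sim^{+}\!\text{-}\mathrm{wit}^+_\sigma(\mathsf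 x_A,\mathsf x_B)=\{(\theta^A_-,x^S,\theta^B_+)\mid x^S\in\mathscr C(S)\ +\text{-covered},\ \theta^A_-:x^S_A\cong_A^-\underline{\mathsf x}_A,\ \theta^B_+:x^S_B\cong_B^+\underline{\mathsf x}_B\}.$$ Let $\sigma:A\stackrel{S}{\to}B$ and $\tau:B\stackrel{T}{\to}C$ be strategies. For $x^S\in\mathscr C(S)$, $x^T\in\mathscr C(T)$ and $\theta:x^S_B\cong_B x^T_B$, consider the induced bijection $$x^S\parallel x^T_C\ \simeq\ x^S_A\parallel x^S_B\parallel x^T_C\ \stackrel{\theta}{\simeq}\ x^S_A\parallel x^T_B\parallel x^T_C\ \simeq\ x^S_A\parallel x^T.$$ It is secured if the relation induced on its graph by the causal orders of its source and target is acyclic. The strategies $\sigma$ and $\tau$ *do not deadlock* if this bijection is secured for all $x^S$, $x^T$ and $\theta$. A configuration $x^T\circledast x^S$ of the interaction $\tau\circledast\sigma$ is a pair with $x^S_B=x^T_B$ for which the bijection with $\theta=\mathrm{id}$ is secured; its events are the elements of the graph, ordered by the transitive closure of the induced relation, and it is $+$-covered if all its maximal events are in $A$ or $C$ and positive in $A^\perp\parallel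 C$. Let $\sim^{+}\!\text{-}\mathrm{int}^+_{\tau\circledast\sigma}(\mathsf x_A,\mathsf x_B,\mathsf x_C)$ be the set of triples $(\theta^A_-,x^T\circledast x^S,\theta^C_+)$ where $x^T\circledast x^S$ is $+$-covered, $x^S_B=x^T_B\cong_B\underline{\mathsf x}_B$, $\theta^A_-:x^S_A\cong_A^-\underline{\mathsf x}_A$ and $\theta^C_+:x^T_C\cong_C^+\underline{\mathsf x}_C$. Write $|X|\in\mathbb N\cup\{+\infty\}$ for the number of elements of $X$, with $0\cdot(+\infty)=0$. **Statement.** Assume that $\sigma:A\stackrel{S}{\to}B$ and $\tau:B\stackrel{T}{\to}C$ do not deadlock. Then for all symmetry classes $\mathsf x_A,\mathsf x_B,\mathsf x_C$ of configurations of $A,B,C$, $$|\sim^{+}\!\text{-}\mathrm{wit}^+_\sigma(\mathsf x_A,\mathsf x_B)|\cdot|\sim^{+}\!\text{-}\mathrm{wit}^+_\tau(\mathsf x_B,\mathsf x_C)|=|\sim^{+}\!\text{-}\mathrm{int}^+_{\tau\circledast\sigma}(\mathsf x_A,\mathsf x_B,\mathsf x_C)|\cdot|\mathrm{Sym}(\mathsf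 x_B)|.$$ -/

import Mathlib

open Set
open scoped SetRel

universe u v w

namespace ThinGames

/-! ### Event structures and their configurations -/

/-- An event structure: a partial order of causality in which every event has finitely many
causes, with a family of consistent finite sets of events. -/
structure EventStructure where
  Event : Type u
  order : PartialOrder Event
  Con : Set (Set Event)
  finite_causes : ∀ e : Event, {e' | e' ≤ e}.Finite
  con_finite : ∀ X ∈ Con, X.Finite
  con_empty : ∅ ∈ Con
  con_singleton : ∀ e : Event, {e} ∈ Con
  con_subset : ∀ X ∈ Con, ∀ Y ⊆ X, Y ∈ Con
  con_cause : ∀ X ∈ Con, ∀ e' ∈ X, ∀ e ≤ e', insert e X ∈ Con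

instance (E : EventStructure.{u}) : PartialOrder E.Event := E.order

/-- A (finite) configuration: a consistent set of events which is closed under causes. -/
def EventStructure.IsConfig (E : EventStructure.{u}) (x : Set E.Event) : Prop :=
  x ∈ E.Con ∧ ∀ e ∈ x, ∀ e' ≤ e, e' ∈ x

/-- The parallel composition of event structures. The order on the sum type is the disjoint
one: events of different components are incomparable. -/
abbrev EventStructure.par (E : EventStructure.{u}) (F : EventStructure.{v}) :
    EventStructure.{max u v} where
  Event := E.Event ⊕ F.Event
  order := inferInstance
  Con := {X | Sum.inl ⁻¹' X ∈ E.Con ∧ Sum.inr ⁻¹' X ∈ F.Con}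
  finite_causes := by
    rintro (e | e)
    · refine ((E.finite_causes e).image Sum.inl).subset ?_
      rintro (a | a) h
      · exact ⟨a, Sum.inl_le_inl_iff.1 h, rfl⟩
      · exact absurd h Sum.not_inr_le_inl
    · refine ((F.finite_causes e).image Sum.inr).subset ?_
      rintro (a | a) h
      · exact absurd h Sum.not_inl_le_inr
      · exact ⟨a, Sum.inr_le_inr_iff.1 h, rfl⟩
  con_finite := by
    rintro X ⟨h1, h2⟩
    refine (((E.con_finite _ h1).image Sum.inl).union
      ((F.con_finite _ h2).image Sum.inr)).subset ?_
    rintro (a | a) h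
    · exact Or.inl ⟨a, h, rfl⟩
    · exact Or.inr ⟨a, h, rfl⟩
  con_empty := ⟨E.con_empty, F.con_empty⟩
  con_singleton := by
    rintro (e | e)
    · exact ⟨E.con_subset _ (E.con_singleton e) _ (by intro a h; simpa using h),
        F.con_subset _ F.con_empty _ (by intro a h; simp at h)⟩
    · exact ⟨E.con_subset _ E.con_empty _ (by intro a h; simp at h),
        F.con_subset _ (F.con_singleton e) _ (by intro a h; simpa using h)⟩
  con_subset := fun X hX Y hY =>
    ⟨E.con_subset _ hX.1 _ (preimage_mono hY), F.con_subset _ hX.2 _ (preimage_mono hY)⟩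
  con_cause := by
    rintro X ⟨h1, h2⟩ (e' | e') he' (e | e) hle
    · exact ⟨E.con_subset _ (E.con_cause _ h1 e' he' e (Sum.inl_le_inl_iff.1 hle)) _
        (by intro a h; simpa using h), F.con_subset _ h2 _ (by intro a h; simpa using h)⟩
    · exact absurd hle Sum.not_inr_le_inl
    · exact absurd hle Sum.not_inl_le_inr
    · exact ⟨E.con_subset _ h1 _ (by intro a h; simpa using h),
        F.con_subset _ (F.con_cause _ h2 e' he' e (Sum.inr_le_inr_iff.1 hle)) _
        (by intro a h; simpa using h)⟩

/-! ### Bijections between configurations, and isomorphism families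

A bijection `θ : x ≃ y` between sets of events is represented by its graph, a set of pairs;
then `x` and `y` are the domain and the codomain of the graph. -/

/-- `θ` is the graph of a bijection from its domain to its codomain. -/
def IsBij {α : Type u} {β : Type v} (θ : SetRel α β) : Prop :=
  InjOn Prod.fst θ ∧ InjOn Prod.snd θ

/-- The graph of the identity of `x`. -/
def idOn {α : Type u} (x : Set α) : SetRel α α := {p | p.1 ∈ x ∧ p.1 = p.2}

/-- The graph of `θ ∥ ψ`. -/
def parRel {α : Type u} {β : Type v} (θ : SetRel α α) (ψ : SetRel β β) :
    SetRel (α ⊕ β) (α ⊕ β) :=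
  {p | Sum.LiftRel (fun a a' => (a, a') ∈ θ) (fun b b' => (b, b') ∈ ψ) p.1 p.2}

/-- An isomorphism family on an event structure: a set of bijections between configurations
which contains identities, is closed under composition and inverse, and has the
restriction and extension properties. -/
structure EventStructure.IsIsoFamily (E : EventStructure.{u})
    (F : Set (SetRel E.Event E.Event)) : Prop where
  bij : ∀ θ ∈ F, IsBij θ
  dom_config : ∀ θ ∈ F, E.IsConfig θ.dom
  cod_config : ∀ θ ∈ F, E.IsConfig θ.cod
  refl : ∀ x, E.IsConfig x → idOn x ∈ F
  symm : ∀ θ ∈ F, θ.inv ∈ F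
  trans : ∀ θ ∈ F, ∀ ψ ∈ F, θ.cod = ψ.dom → θ ○ ψ ∈ F
  restrict : ∀ θ ∈ F, ∀ x ⊆ θ.dom, E.IsConfig x → {p ∈ θ | p.1 ∈ x} ∈ F
  extend : ∀ θ ∈ F, ∀ x, θ.dom ⊆ x → E.IsConfig x → ∃ θ' ∈ F, θ ⊆ θ' ∧ θ'.dom = x

/-- The bijections `θ ∥ ψ` with `θ` in `F` and `ψ` in `G`. -/
def parFamily {α : Type u} {β : Type v} (F : Set (SetRel α α)) (G : Set (SetRel β β)) :
    Set (SetRel (α ⊕ β) (α ⊕ β)) :=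
  {χ | ∃ θ ∈ F, ∃ ψ ∈ G, χ = parRel θ ψ}

@[simp] theorem mem_parRel_inl_inl {α : Type u} {β : Type v} {θ : SetRel α α}
    {ψ : SetRel β β} {a a' : α} :
    ((Sum.inl a, Sum.inl a') : (α ⊕ β) × (α ⊕ β)) ∈ parRel θ ψ ↔ (a, a') ∈ θ := by
  simp [parRel]

@[simp] theorem mem_parRel_inr_inr {α : Type u} {β : Type v} {θ : SetRel α α}
    {ψ : SetRel β β} {b b' : β} :
    ((Sum.inr b, Sum.inr b') : (α ⊕ β) × (α ⊕ β)) ∈ parRel θ ψ ↔ (b, b') ∈ ψ := by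
  simp [parRel]

@[simp] theorem mem_parRel_inl_inr {α : Type u} {β : Type v} {θ : SetRel α α}
    {ψ : SetRel β β} {a : α} {b : β} :
    ((Sum.inl a, Sum.inr b) : (α ⊕ β) × (α ⊕ β)) ∈ parRel θ ψ ↔ False := by
  simp [parRel]

@[simp] theorem mem_parRel_inr_inl {α : Type u} {β : Type v} {θ : SetRel α α}
    {ψ : SetRel β β} {a : α} {b : β} :
    ((Sum.inr b, Sum.inl a) : (α ⊕ β) × (α ⊕ β)) ∈ parRel θ ψ ↔ False := by
  simp [parRel]

@[simp] theorem mem_idOn {α : Type u} {x : Set α} {a b : α} :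
    (a, b) ∈ idOn x ↔ a ∈ x ∧ a = b := Iff.rfl

theorem isConfig_par {E : EventStructure.{u}} {F : EventStructure.{v}}
    {x : Set (E.Event ⊕ F.Event)} :
    (E.par F).IsConfig x ↔ E.IsConfig (Sum.inl ⁻¹' x) ∧ F.IsConfig (Sum.inr ⁻¹' x) := by
  constructor
  · rintro ⟨⟨h1, h2⟩, h⟩
    exact ⟨⟨h1, fun e he e' hle => h _ he _ (Sum.inl_le_inl_iff.2 hle)⟩,
      ⟨h2, fun e he e' hle => h _ he _ (Sum.inr_le_inr_iff.2 hle)⟩⟩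
  · rintro ⟨⟨h1, h1'⟩, ⟨h2, h2'⟩⟩
    refine ⟨⟨h1, h2⟩, ?_⟩
    rintro (e | e) he (e' | e') hle
    · exact h1' e he e' (Sum.inl_le_inl_iff.1 hle)
    · exact absurd hle Sum.not_inr_le_inl
    · exact absurd hle Sum.not_inl_le_inr
    · exact h2' e he e' (Sum.inr_le_inr_iff.1 hle)

theorem dom_parRel_inl {α : Type u} {β : Type v} (θ : SetRel α α) (ψ : SetRel β β) :
    Sum.inl ⁻¹' (parRel θ ψ).dom = θ.dom := by
  ext a; simp [SetRel.dom]

theorem dom_parRel_inr {α : Type u} {β : Type v} (θ : SetRel α α) (ψ : SetRel β β) :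
    Sum.inr ⁻¹' (parRel θ ψ).dom = ψ.dom := by
  ext a; simp [SetRel.dom]

theorem cod_parRel_inl {α : Type u} {β : Type v} (θ : SetRel α α) (ψ : SetRel β β) :
    Sum.inl ⁻¹' (parRel θ ψ).cod = θ.cod := by
  ext a; simp [SetRel.cod]

theorem cod_parRel_inr {α : Type u} {β : Type v} (θ : SetRel α α) (ψ : SetRel β β) :
    Sum.inr ⁻¹' (parRel θ ψ).cod = ψ.cod := by
  ext a; simp [SetRel.cod]

theorem EventStructure.IsIsoFamily.par {E : EventStructure.{u}} {F : EventStructure.{v}}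
    {P : Set (SetRel E.Event E.Event)} {Q : Set (SetRel F.Event F.Event)}
    (hP : E.IsIsoFamily P) (hQ : F.IsIsoFamily Q) :
    (E.par F).IsIsoFamily (parFamily P Q) where
  bij := by
    rintro _ ⟨θ, hθ, ψ, hψ, rfl⟩
    obtain ⟨h1, h2⟩ := hP.bij θ hθ
    obtain ⟨h3, h4⟩ := hQ.bij ψ hψ
    constructor
    · rintro ⟨a | a, b | b⟩ hp ⟨c | c, d | d⟩ hq h <;> simp at hp hq h
      · subst h; simpa using h1 hp hq rfl
      · subst h; simpa using h3 hp hq rfl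
    · rintro ⟨a | a, b | b⟩ hp ⟨c | c, d | d⟩ hq h <;> simp at hp hq h
      · subst h; simpa using h2 hp hq rfl
      · subst h; simpa using h4 hp hq rfl
  dom_config := by
    rintro _ ⟨θ, hθ, ψ, hψ, rfl⟩
    rw [isConfig_par, dom_parRel_inl, dom_parRel_inr]
    exact ⟨hP.dom_config θ hθ, hQ.dom_config ψ hψ⟩
  cod_config := by
    rintro _ ⟨θ, hθ, ψ, hψ, rfl⟩
    rw [isConfig_par, cod_parRel_inl, cod_parRel_inr]
    exact ⟨hP.cod_config θ hθ, hQ.cod_config ψ hψ⟩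
  refl := by
    intro x hx
    rw [isConfig_par] at hx
    refine ⟨_, hP.refl _ hx.1, _, hQ.refl _ hx.2, ?_⟩
    ext ⟨a | a, b | b⟩ <;> simp
  symm := by
    rintro _ ⟨θ, hθ, ψ, hψ, rfl⟩
    refine ⟨_, hP.symm _ hθ, _, hQ.symm _ hψ, ?_⟩
    ext ⟨a | a, b | b⟩ <;> simp [SetRel.inv]
  trans := by
    rintro _ ⟨θ, hθ, ψ, hψ, rfl⟩ _ ⟨θ', hθ', ψ', hψ', rfl⟩ h
    refine ⟨_, hP.trans θ hθ θ' hθ' ?_, _, hQ.trans ψ hψ ψ' hψ' ?_, ?_⟩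
    · rw [← cod_parRel_inl θ ψ, h, dom_parRel_inl]
    · rw [← cod_parRel_inr θ ψ, h, dom_parRel_inr]
    · ext ⟨a | a, b | b⟩ <;> simp [SetRel.comp]
  restrict := by
    rintro _ ⟨θ, hθ, ψ, hψ, rfl⟩ x hx hc
    rw [isConfig_par] at hc
    refine ⟨_, hP.restrict θ hθ _ ?_ hc.1, _, hQ.restrict ψ hψ _ ?_ hc.2, ?_⟩
    · rw [← dom_parRel_inl θ ψ]; exact preimage_mono hx
    · rw [← dom_parRel_inr θ ψ]; exact preimage_mono hx
    · ext ⟨a | a, b | b⟩ <;> simp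
  extend := by
    rintro _ ⟨θ, hθ, ψ, hψ, rfl⟩ x hx hc
    rw [isConfig_par] at hc
    obtain ⟨θ', hθ', h1, h2⟩ := hP.extend θ hθ _
      (by rw [← dom_parRel_inl θ ψ]; exact preimage_mono hx) hc.1
    obtain ⟨ψ', hψ', h3, h4⟩ := hQ.extend ψ hψ _
      (by rw [← dom_parRel_inr θ ψ]; exact preimage_mono hx) hc.2
    refine ⟨_, ⟨θ', hθ', ψ', hψ', rfl⟩, ?_, ?_⟩
    · rintro ⟨a | a, b | b⟩ hp <;> simp at hp ⊢
      · exact h1 hp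
      · exact h3 hp
    · ext (a | a)
      · exact Set.ext_iff.1 ((dom_parRel_inl θ' ψ').trans h2) a
      · exact Set.ext_iff.1 ((dom_parRel_inr θ' ψ').trans h4) a

/-! ### Polarities, symmetry, thin concurrent games -/

/-- Opponent moves are negative, Player moves are positive. -/
inductive Polarity where
  | minus
  | plus

/-- Exchange of polarities. -/
def Polarity.flip : Polarity → Polarity
  | minus => plus
  | plus => minus

/-- An event structure with symmetry and polarities. -/
structure SymEventStructure extends EventStructure.{u} where
  pol : Event → Polarity
  sym : Set (SetRel Event Event)
  sym_isIsoFamily : toEventStructure.IsIsoFamily sym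
  sym_pol : ∀ θ ∈ sym, ∀ p ∈ θ, pol p.1 = pol p.2

/-- A thin concurrent game: an event structure with symmetry and polarities, with
a positive and a negative subsymmetry. -/
structure TCG extends SymEventStructure.{u} where
  pos : Set (SetRel Event Event)
  neg : Set (SetRel Event Event)
  pos_isIsoFamily : toEventStructure.IsIsoFamily pos
  neg_isIsoFamily : toEventStructure.IsIsoFamily neg
  pos_subset : pos ⊆ sym
  neg_subset : neg ⊆ sym
  eq_id_of_pos_of_neg : ∀ θ ∈ pos, θ ∈ neg → ∀ p ∈ θ, p.1 = p.2
  pos_extension : ∀ θ ∈ pos, ∀ θ' ∈ sym, θ ⊆ θ' →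
    (∀ p ∈ θ', p ∉ θ → pol p.1 = Polarity.plus) → θ' ∈ pos
  neg_extension : ∀ θ ∈ neg, ∀ θ' ∈ sym, θ ⊆ θ' →
    (∀ p ∈ θ', p ∉ θ → pol p.1 = Polarity.minus) → θ' ∈ neg

/-- The dual game: polarities, and the positive and negative symmetries, are exchanged. -/
abbrev TCG.dual (A : TCG.{u}) : TCG.{u} where
  toEventStructure := A.toEventStructure
  pol e := (A.pol e).flip
  sym := A.sym
  sym_isIsoFamily := A.sym_isIsoFamily
  sym_pol θ hθ p hp := congrArg Polarity.flip (A.sym_pol θ hθ p hp)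
  pos := A.neg
  neg := A.pos
  pos_isIsoFamily := A.neg_isIsoFamily
  neg_isIsoFamily := A.pos_isIsoFamily
  pos_subset := A.neg_subset
  neg_subset := A.pos_subset
  eq_id_of_pos_of_neg θ h1 h2 := A.eq_id_of_pos_of_neg θ h2 h1
  pos_extension θ hθ θ' hθ' hs hp := A.neg_extension θ hθ θ' hθ' hs (by
    intro p h1 h2
    have h := hp p h1 h2
    cases hq : A.pol p.1 <;> simp_all [Polarity.flip])
  neg_extension θ hθ θ' hθ' hs hp := A.pos_extension θ hθ θ' hθ' hs (by
    intro p h1 h2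
    have h := hp p h1 h2
    cases hq : A.pol p.1 <;> simp_all [Polarity.flip])

/-- The parallel composition of games. -/
abbrev TCG.par (A : TCG.{u}) (B : TCG.{v}) : TCG.{max u v} where
  toEventStructure := A.toEventStructure.par B.toEventStructure
  pol := Sum.elim A.pol B.pol
  sym := parFamily A.sym B.sym
  sym_isIsoFamily := A.sym_isIsoFamily.par B.sym_isIsoFamily
  sym_pol := by
    rintro _ ⟨θ, hθ, ψ, hψ, rfl⟩ ⟨a | a, b | b⟩ hp <;> simp at hp ⊢
    · exact A.sym_pol θ hθ _ hp
    · exact B.sym_pol ψ hψ _ hp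
  pos := parFamily A.pos B.pos
  neg := parFamily A.neg B.neg
  pos_isIsoFamily := A.pos_isIsoFamily.par B.pos_isIsoFamily
  neg_isIsoFamily := A.neg_isIsoFamily.par B.neg_isIsoFamily
  pos_subset := by
    rintro _ ⟨θ, hθ, ψ, hψ, rfl⟩
    exact ⟨θ, A.pos_subset hθ, ψ, B.pos_subset hψ, rfl⟩
  neg_subset := by
    rintro _ ⟨θ, hθ, ψ, hψ, rfl⟩
    exact ⟨θ, A.neg_subset hθ, ψ, B.neg_subset hψ, rfl⟩
  eq_id_of_pos_of_neg := by
    rintro _ ⟨θ, hθ, ψ, hψ, rfl⟩ ⟨θ', hθ', ψ', hψ', h⟩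
    have e1 : θ = θ' := by
      ext ⟨a, b⟩
      have := Set.ext_iff.1 h (Sum.inl a, Sum.inl b)
      simpa using this
    have e2 : ψ = ψ' := by
      ext ⟨a, b⟩
      have := Set.ext_iff.1 h (Sum.inr a, Sum.inr b)
      simpa using this
    subst e1 e2
    rintro ⟨a | a, b | b⟩ hp <;> simp at hp ⊢
    · exact A.eq_id_of_pos_of_neg θ hθ hθ' _ hp
    · exact B.eq_id_of_pos_of_neg ψ hψ hψ' _ hp
  pos_extension := by
    rintro _ ⟨θ, hθ, ψ, hψ, rfl⟩ _ ⟨θ', hθ', ψ', hψ', rfl⟩ hs hp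
    refine ⟨θ', A.pos_extension θ hθ θ' hθ' ?_ ?_, ψ', B.pos_extension ψ hψ ψ' hψ' ?_ ?_, rfl⟩
    · rintro ⟨a, b⟩ h
      simpa using @hs (Sum.inl a, Sum.inl b) (by simpa using h)
    · rintro ⟨a, b⟩ h1 h2
      simpa using hp (Sum.inl a, Sum.inl b) (by simpa using h1) (by simpa using h2)
    · rintro ⟨a, b⟩ h
      simpa using @hs (Sum.inr a, Sum.inr b) (by simpa using h)
    · rintro ⟨a, b⟩ h1 h2
      simpa using hp (Sum.inr a, Sum.inr b) (by simpa using h1) (by simpa using h2)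
  neg_extension := by
    rintro _ ⟨θ, hθ, ψ, hψ, rfl⟩ _ ⟨θ', hθ', ψ', hψ', rfl⟩ hs hp
    refine ⟨θ', A.neg_extension θ hθ θ' hθ' ?_ ?_, ψ', B.neg_extension ψ hψ ψ' hψ' ?_ ?_, rfl⟩
    · rintro ⟨a, b⟩ h
      simpa using @hs (Sum.inl a, Sum.inl b) (by simpa using h)
    · rintro ⟨a, b⟩ h1 h2
      simpa using hp (Sum.inl a, Sum.inl b) (by simpa using h1) (by simpa using h2)
    · rintro ⟨a, b⟩ h
      simpa using @hs (Sum.inr a, Sum.inr b) (by simpa using h)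
    · rintro ⟨a, b⟩ h1 h2
      simpa using hp (Sum.inr a, Sum.inr b) (by simpa using h1) (by simpa using h2)

/-- The set of all `θ : x ≃ y` in the family `F`. -/
def symBetween {α : Type u} (F : Set (SetRel α α)) (x y : Set α) : Set (SetRel α α) :=
  {θ | θ ∈ F ∧ θ.dom = x ∧ θ.cod = y}

/-! ### Symmetry classes -/

/-- The configurations of a game. -/
def TCG.Config (A : TCG.{u}) : Type u := {x : Set A.Event // A.IsConfig x}

theorem dom_idOn {α : Type u} (x : Set α) : (idOn x).dom = x := by
  ext a; simp [SetRel.dom]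

theorem cod_idOn {α : Type u} (x : Set α) : (idOn x).cod = x := by
  ext a; simp [SetRel.cod]

/-- Two configurations are symmetric if there is a symmetry between them. -/
instance TCG.configSetoid (A : TCG.{u}) : Setoid A.Config where
  r x y := (symBetween A.sym x.1 y.1).Nonempty
  iseqv :=
    { refl := fun x => ⟨idOn x.1, A.sym_isIsoFamily.refl _ x.2, dom_idOn _, cod_idOn _⟩
      symm := by
        rintro x y ⟨θ, h, h1, h2⟩
        exact ⟨θ.inv, A.sym_isIsoFamily.symm _ h, by rw [← h2]; rfl, by rw [← h1]; rfl⟩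
      trans := by
        rintro x y z ⟨θ, h, h1, h2⟩ ⟨ψ, k, k1, k2⟩
        refine ⟨θ ○ ψ, A.sym_isIsoFamily.trans _ h _ k (h2.trans k1.symm), ?_, ?_⟩
        · rw [← h1]
          ext a
          constructor
          · rintro ⟨c, b, hab, hbc⟩
            exact ⟨b, hab⟩
          · rintro ⟨b, hab⟩
            obtain ⟨c, hbc⟩ : b ∈ ψ.dom := by rw [k1, ← h2]; exact ⟨a, hab⟩
            exact ⟨c, b, hab, hbc⟩
        · rw [← k2]
          ext c
          constructor
          · rintro ⟨a, b, hab, hbc⟩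
            exact ⟨b, hbc⟩
          · rintro ⟨b, hbc⟩
            obtain ⟨a, hab⟩ : b ∈ θ.cod := by rw [h2, ← k1]; exact ⟨c, hbc⟩
            exact ⟨a, b, hab, hbc⟩ }

/-- The symmetry classes of configurations of a game. -/
def TCG.SymClass (A : TCG.{u}) : Type u := Quotient A.configSetoid

/-- A choice of a representative in every symmetry class of a game. -/
structure TCG.Representatives (A : TCG.{u}) where
  rep : A.SymClass → A.Config
  rep_mem : ∀ x : A.SymClass, Quotient.mk A.configSetoid (rep x) = x

/-! ### Strategies -/

/-- The image of a bijection between configurations under a map of events. -/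
def mapRel {α : Type u} {β : Type v} (f : α → β) (θ : SetRel α α) : SetRel β β :=
  Prod.map f f '' θ

/-- A strategy on a game: a map of event structures with symmetry and polarities which is
receptive, courteous and receptive to symmetries, and whose source is thin. -/
structure Strategy (G : TCG.{u}) where
  S : SymEventStructure.{v}
  map : S.Event → G.Event
  map_isConfig : ∀ x, S.IsConfig x → G.IsConfig (map '' x)
  map_injOn : ∀ x, S.IsConfig x → InjOn map x
  map_pol : ∀ s, G.pol (map s) = S.pol s
  map_sym : ∀ θ ∈ S.sym, mapRel map θ ∈ G.sym
  receptive : ∀ x, S.IsConfig x → ∀ a, a ∉ map '' x → G.pol a = Polarity.minus →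
    G.IsConfig (insert a (map '' x)) → ∃! s, S.IsConfig (insert s x) ∧ map s = a
  courteous : ∀ s t : S.Event, s ⋖ t → S.pol s = Polarity.plus ∨ S.pol t = Polarity.minus →
    map s ⋖ map t
  sym_receptive : ∀ θ ∈ S.sym, ∀ s, s ∉ θ.dom → S.pol s = Polarity.minus →
    S.IsConfig (insert s θ.dom) → ∀ b, insert (map s, b) (mapRel map θ) ∈ G.sym →
    ∃! t, insert (s, t) θ ∈ S.sym ∧ map t = b
  thin : ∀ θ ∈ S.sym, ∀ s, s ∉ θ.dom → S.pol s = Polarity.plus →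
    ∀ t t', insert (s, t) θ ∈ S.sym → insert (s, t') θ ∈ S.sym → t = t'

/-- A strategy from `A` to `B` is a strategy on `A^⊥ ∥ B`. -/
abbrev Strat (A : TCG.{u}) (B : TCG.{u}) := Strategy.{u, v} (A.dual.par B)

section Strat

variable {A B : TCG.{u}} (σ : Strat.{u, v} A B)

/-- The component `x_A` of `σ x = x_A ∥ x_B`. -/
def Strategy.left (x : Set σ.S.Event) : Set A.Event := Sum.inl ⁻¹' (σ.map '' x)

/-- The component `x_B` of `σ x = x_A ∥ x_B`. -/
def Strategy.right (x : Set σ.S.Event) : Set B.Event := Sum.inr ⁻¹' (σ.map '' x)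

end Strat

/-- A set of events is `+`-covered if all its maximal events are positive. -/
def PlusCovered (E : SymEventStructure.{u}) (x : Set E.Event) : Prop :=
  ∀ s, Maximal (· ∈ x) s → E.pol s = Polarity.plus

/-! ### Interaction -/

/-- One-step causality between the elements of a bijection `φ` between ordered sets:
`(a, b)` is before `(a', b')` if `a < a'` or `b < b'`. -/
def Before {α : Type u} {β : Type v} [LT α] [LT β] (φ : SetRel α β) (p q : α × β) : Prop :=
  p ∈ φ ∧ q ∈ φ ∧ (p.1 < q.1 ∨ p.2 < q.2)

/-- A bijection between ordered sets is secured if the causality that it induces on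
its graph is acyclic. -/
def Secured {α : Type u} {β : Type v} [LT α] [LT β] (φ : SetRel α β) : Prop :=
  ∀ p, ¬ Relation.TransGen (Before φ) p p

section Interaction

variable {A B C : TCG.{u}} (σ : Strat.{u, v} A B) (τ : Strat.{u, w} B C)

/-- The composite of `σ ∥ x_C : x ∥ y_C ≃ x_A ∥ x_B ∥ y_C`, of `x_A ∥ θ ∥ y_C` and of
`x_A ∥ τ⁻¹ : x_A ∥ y_B ∥ y_C ≃ x_A ∥ y`, for configurations `x` of `σ` and `y` of `τ`
and `θ : x_B ≃ y_B`. -/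
inductive SyncStep (x : Set σ.S.Event) (y : Set τ.S.Event) (θ : SetRel B.Event B.Event) :
    σ.S.Event ⊕ C.Event → A.Event ⊕ τ.S.Event → Prop
  | left (s : σ.S.Event) (a : A.Event) (hs : s ∈ x) (ha : σ.map s = Sum.inl a) :
      SyncStep x y θ (Sum.inl s) (Sum.inl a)
  | mid (s : σ.S.Event) (t : τ.S.Event) (b b' : B.Event) (hs : s ∈ x) (ht : t ∈ y)
      (hb : σ.map s = Sum.inr b) (hb' : τ.map t = Sum.inl b') (h : (b, b') ∈ θ) :
      SyncStep x y θ (Sum.inl s) (Sum.inr t)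
  | right (t : τ.S.Event) (c : C.Event) (ht : t ∈ y) (hc : τ.map t = Sum.inr c) :
      SyncStep x y θ (Sum.inr c) (Sum.inr t)

/-- The graph of the composite bijection `x ∥ y_C ≃ x_A ∥ y`. -/
def sync (x : Set σ.S.Event) (y : Set τ.S.Event) (θ : SetRel B.Event B.Event) :
    SetRel (σ.S.Event ⊕ C.Event) (A.Event ⊕ τ.S.Event) :=
  {p | SyncStep σ τ x y θ p.1 p.2}

/-- The strategies `σ` and `τ` do not deadlock: for all configurations `x` and `y` and every
symmetry `θ : x_B ≅ y_B`, the composite bijection `x ∥ y_C ≃ x_A ∥ y` is secured. -/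
def DoNotDeadlock : Prop :=
  ∀ x y, σ.S.IsConfig x → τ.S.IsConfig y → ∀ θ ∈ symBetween B.sym (σ.right x) (τ.left y),
    Secured (sync σ τ x y θ)

/-- A configuration of the interaction of `σ` and `τ`: a pair of configurations which agree
on `B` and are causally compatible. -/
structure InteractionConfig where
  fst : Set σ.S.Event
  snd : Set τ.S.Event
  fst_isConfig : σ.S.IsConfig fst
  snd_isConfig : τ.S.IsConfig snd
  matching : σ.right fst = τ.left snd
  secured : Secured (sync σ τ fst snd (idOn (σ.right fst)))

variable {σ τ}

/-- The events of a configuration of the interaction: the elements of the secured bijection.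
Their causal order is generated by `Before`. -/
def InteractionConfig.events (z : InteractionConfig σ τ) :
    SetRel (σ.S.Event ⊕ C.Event) (A.Event ⊕ τ.S.Event) :=
  sync σ τ z.fst z.snd (idOn (σ.right z.fst))

/-- The events of an interaction that are positive: those in `A` or `C` that are positive
in `A^⊥ ∥ C`. The synchronized events, in `B`, are neither positive nor negative. -/
def PositiveEvent : (σ.S.Event ⊕ C.Event) × (A.Event ⊕ τ.S.Event) → Prop
  | (Sum.inl _, Sum.inl a) => A.dual.pol a = Polarity.plus
  | (Sum.inr c, Sum.inr _) => C.pol c = Polarity.plus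
  | _ => False

/-- A configuration of the interaction is `+`-covered if all its maximal events, for
the causal order of the interaction, are positive. -/
def InteractionConfig.PlusCovered (z : InteractionConfig σ τ) : Prop :=
  ∀ p ∈ z.events, (∀ q, ¬ Relation.TransGen (Before z.events) p q) → PositiveEvent p

end Interaction

/-! ### Witnesses -/

/-- The set `∼⁺-wit⁺_σ(x_A, x_B)`, for representatives `a` of `x_A` and `b` of `x_B`:
`+`-covered configurations `x` of `σ` with a negative symmetry `x_A ≅⁻ a` and a
positive symmetry `x_B ≅⁺ b`. -/
structure SymWitness {A B : TCG.{u}} (σ : Strat.{u, v} A B) (a : A.Config) (b : B.Config) where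
  config : Set σ.S.Event
  isConfig : σ.S.IsConfig config
  plusCovered : PlusCovered σ.S config
  symA : SetRel A.Event A.Event
  symA_mem : symA ∈ symBetween A.neg (σ.left config) a.1
  symB : SetRel B.Event B.Event
  symB_mem : symB ∈ symBetween B.pos (σ.right config) b.1

/-- The set `∼⁺-int⁺_{τ⊛σ}(x_A, x_B, x_C)`, for representatives `a`, `b`, `c` of the classes:
`+`-covered configurations of the interaction, whose component in `B` is symmetric to `b`, with a
negative symmetry to `a` in `A` and a positive symmetry to `c` in `C`. -/
structure SymInteractionWitness {A B C : TCG.{u}} (σ : Strat.{u, v} A B) (τ : Strat.{u, w} B C)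
    (a : A.Config) (b : B.Config) (c : C.Config) where
  config : InteractionConfig σ τ
  plusCovered : config.PlusCovered
  symA : SetRel A.Event A.Event
  symA_mem : symA ∈ symBetween A.neg (σ.left config.fst) a.1
  symB_nonempty : (symBetween B.sym (σ.right config.fst) b.1).Nonempty
  symC : SetRel C.Event C.Event
  symC_mem : symC ∈ symBetween C.pos (τ.right config.snd) c.1

/-- The set `Sym(x)` of endosymmetries of a configuration. -/
def EndoSym {A : TCG.{u}} (x : A.Config) : Type u := symBetween A.sym x.1 x.1

end ThinGames

/-! The identity of cardinals comes from a bijection, so infinite sets need no separate treatment.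
Two witnesses `(θA, x, θB)` and `(ψB, y, ψC)` need not agree on `B`: their components there match
only up to the symmetry `θB ○ ψB⁻¹`. Moving `x` and `y` along symmetries of the two strategies makes
them agree exactly. The outcome is a witness of the interaction together with one more datum, a
symmetry `χ` from its component in `B` to the representative `b`. For a fixed interaction these `χ`
form a nonempty torsor under the endosymmetries of `b`, and this is the factor `Sym`.

The correspondence is the relation `Synchronizes`: symmetries `φ` of `σ` and `ψ` of `τ` lead from
the interaction to the pair and commute with all symmetries to `a`, `b`, `c`. It is total and
single-valued in both directions.

From pairs to interactions, existence is `exists_synchronization`. The absence of deadlock provides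
a causal order on the matched configurations, along which `φ` and `ψ` are built event by event. At
an event of `B`, the strategy for which it is positive extends its symmetry freely, and the other
one follows by receptivity to symmetries. Uniqueness is `eq_idOn_of_synchronized`: with the data in
`A` and `C` restricted to negative and positive symmetries, thinness of one strategy and receptivity
of the other leave no freedom.

From interactions to pairs, `χ` is an arbitrary symmetry of `B`. Every symmetry out of the image of
a configuration factors as the image of a symmetry of the strategy followed by a positive symmetry
of the game (`exists_factorization`), with a unique positive part (`factorization_unique`). In `A^⊥
∥ B`, positive means negative on `A` and positive on `B`, which is the shape required of a witness.

Coveredness is transported because symmetries are order isomorphisms and because, by courtesy, an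
interaction is `+`-covered exactly when both of its components are. -/

namespace ThinGames

/-! ### Calculus of partial bijections -/

section Relations

variable {α : Type u} {β : Type v} {γ : Type w}

theorem IsBij.comp_inv {θ : SetRel α β} (h : IsBij θ) : θ ○ θ.inv = idOn θ.dom := by
  ext ⟨a, b⟩
  constructor
  · rintro ⟨c, h1, h2⟩
    exact ⟨⟨c, h1⟩, congrArg Prod.fst (h.2 h1 h2 rfl)⟩
  · rintro ⟨⟨c, h1⟩, h2⟩
    obtain rfl : a = b := h2
    exact ⟨c, h1, h1⟩

theorem IsBij.inv {θ : SetRel α β} (h : IsBij θ) : IsBij θ.inv := by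
  constructor
  · rintro ⟨a, b⟩ hp ⟨c, d⟩ hq e
    have := h.2 (show (b, a) ∈ θ from hp) (show (d, c) ∈ θ from hq) e
    simp_all
  · rintro ⟨a, b⟩ hp ⟨c, d⟩ hq e
    have := h.1 (show (b, a) ∈ θ from hp) (show (d, c) ∈ θ from hq) e
    simp_all

theorem IsBij.inv_comp {θ : SetRel α β} (h : IsBij θ) : θ.inv ○ θ = idOn θ.cod :=
  h.inv.comp_inv

theorem IsBij.right_unique {θ : SetRel α β} (h : IsBij θ) {a : α} {b c : β}
    (h1 : (a, b) ∈ θ) (h2 : (a, c) ∈ θ) : b = c :=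
  congrArg Prod.snd (h.1 h1 h2 rfl)

theorem IsBij.left_unique {θ : SetRel α β} (h : IsBij θ) {a b : α} {c : β}
    (h1 : (a, c) ∈ θ) (h2 : (b, c) ∈ θ) : a = b :=
  congrArg Prod.fst (h.2 h1 h2 rfl)

theorem idOn_comp {x : Set α} {θ : SetRel α β} (h : θ.dom = x) : idOn x ○ θ = θ := by
  ext ⟨a, b⟩
  constructor
  · rintro ⟨c, ⟨-, h1⟩, h2⟩
    obtain rfl : a = c := h1
    exact h2
  · intro h1
    exact ⟨a, ⟨h ▸ ⟨b, h1⟩, rfl⟩, h1⟩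

theorem comp_idOn {x : Set β} {θ : SetRel α β} (h : θ.cod = x) : θ ○ idOn x = θ := by
  ext ⟨a, b⟩
  constructor
  · rintro ⟨c, h1, -, h2⟩
    obtain rfl : c = b := h2
    exact h1
  · intro h1
    exact ⟨b, h1, h ▸ ⟨a, h1⟩, rfl⟩

theorem eq_idOn_of_forall {θ : SetRel α α} {x : Set α} (hx : θ.dom = x)
    (h : ∀ p ∈ θ, p.1 = p.2) : θ = idOn x := by
  ext ⟨a, b⟩
  constructor
  · intro h1
    exact ⟨hx ▸ ⟨b, h1⟩, h _ h1⟩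
  · rintro ⟨h1, h2⟩
    obtain rfl : a = b := h2
    obtain ⟨b, h3⟩ : a ∈ θ.dom := hx ▸ h1
    obtain rfl : a = b := h _ h3
    exact h3

theorem dom_comp_of_cod_eq_dom {θ : SetRel α β} {ψ : SetRel β γ} (h : θ.cod = ψ.dom) :
    (θ ○ ψ).dom = θ.dom := by
  ext a
  constructor
  · rintro ⟨c, b, hab, hbc⟩
    exact ⟨b, hab⟩
  · rintro ⟨b, hab⟩
    obtain ⟨c, hbc⟩ : b ∈ ψ.dom := h ▸ ⟨a, hab⟩
    exact ⟨c, b, hab, hbc⟩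

theorem cod_comp_of_cod_eq_dom {θ : SetRel α β} {ψ : SetRel β γ} (h : θ.cod = ψ.dom) :
    (θ ○ ψ).cod = ψ.cod := by
  ext c
  constructor
  · rintro ⟨a, b, hab, hbc⟩
    exact ⟨b, hbc⟩
  · rintro ⟨b, hbc⟩
    obtain ⟨a, hab⟩ : b ∈ θ.cod := h ▸ ⟨c, hbc⟩
    exact ⟨a, b, hab, hbc⟩

theorem inv_comp_eq_of_eq_comp {θ : SetRel α β} {ψ : SetRel β γ} {χ : SetRel α γ} (h : IsBij θ)
    (h1 : θ.cod = ψ.dom) (e : χ = θ ○ ψ) : θ.inv ○ χ = ψ := by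
  rw [e, ← SetRel.comp_assoc, h.inv_comp, idOn_comp h1.symm]

theorem dom_insert (a : α) (b : β) (θ : SetRel α β) :
    SetRel.dom (insert (a, b) θ) = insert a θ.dom := by
  ext c
  simp only [SetRel.mem_dom, mem_insert_iff, Prod.mk.injEq]
  constructor
  · rintro ⟨d, ⟨rfl, -⟩ | h⟩
    · exact Or.inl rfl
    · exact Or.inr ⟨d, h⟩
  · rintro (rfl | ⟨d, h⟩)
    · exact ⟨b, Or.inl ⟨rfl, rfl⟩⟩
    · exact ⟨d, Or.inr h⟩

theorem cod_insert (a : α) (b : β) (θ : SetRel α β) :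
    SetRel.cod (insert (a, b) θ) = insert b θ.cod := by
  ext c
  simp only [SetRel.mem_cod, mem_insert_iff, Prod.mk.injEq]
  constructor
  · rintro ⟨d, ⟨-, rfl⟩ | h⟩
    · exact Or.inl rfl
    · exact Or.inr ⟨d, h⟩
  · rintro (rfl | ⟨d, h⟩)
    · exact ⟨a, Or.inl ⟨rfl, rfl⟩⟩
    · exact ⟨d, Or.inr h⟩

theorem insert_idOn (a : α) (x : Set α) : insert (a, a) (idOn x) = idOn (insert a x) := by
  ext ⟨b, c⟩
  simp only [mem_insert_iff, Prod.mk.injEq, mem_idOn]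
  constructor
  · rintro (⟨rfl, rfl⟩ | ⟨h, rfl⟩)
    · exact ⟨Or.inl rfl, rfl⟩
    · exact ⟨Or.inr h, rfl⟩
  · rintro ⟨rfl | h, rfl⟩
    · exact Or.inl ⟨rfl, rfl⟩
    · exact Or.inr ⟨h, rfl⟩

theorem inv_insert (a : α) (b : β) (θ : SetRel α β) :
    SetRel.inv (insert (a, b) θ) = insert (b, a) θ.inv := by
  ext ⟨c, d⟩
  simp [and_comm]

theorem insert_comp_insert {a : α} {b : β} {c : γ} {θ : SetRel α β} {ψ : SetRel β γ}
    (h1 : b ∉ θ.cod) (h2 : b ∉ ψ.dom) :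
    SetRel.comp (insert (a, b) θ) (insert (b, c) ψ) = insert (a, c) (θ ○ ψ) := by
  ext ⟨p, q⟩
  simp only [SetRel.mem_comp, mem_insert_iff, Prod.mk.injEq]
  constructor
  · rintro ⟨d, ⟨rfl, rfl⟩ | h3, ⟨h, rfl⟩ | h4⟩
    · exact Or.inl ⟨rfl, rfl⟩
    · exact absurd ⟨q, h4⟩ h2
    · subst h
      exact absurd ⟨p, h3⟩ h1
    · exact Or.inr ⟨d, h3, h4⟩
  · rintro (⟨rfl, rfl⟩ | ⟨d, h3, h4⟩)
    · exact ⟨b, Or.inl ⟨rfl, rfl⟩, Or.inl ⟨rfl, rfl⟩⟩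
    · exact ⟨d, Or.inr h3, Or.inr h4⟩

theorem eq_comp_inv_of_comp_eq {θ : SetRel α β} {ψ : SetRel β γ} {χ : SetRel α γ}
    (h : IsBij ψ) (h1 : θ.cod = ψ.dom) (e : θ ○ ψ = χ) : θ = χ ○ ψ.inv := by
  rw [← e, SetRel.comp_assoc, h.comp_inv, comp_idOn h1]

/-- A bijection whose domain is `insert a x` splits off the pair at `a`. -/
theorem IsBij.exists_eq_insert {θ : SetRel α β} (h : IsBij θ) {a : α} {x : Set α} (ha : a ∉ x)
    (hx : θ.dom = insert a x) :
    ∃ b, ∃ θ' ⊆ θ, θ = insert (a, b) θ' ∧ θ'.dom = x ∧ b ∉ θ'.cod := by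
  obtain ⟨b, hb⟩ : a ∈ θ.dom := hx ▸ mem_insert a x
  refine ⟨b, {p ∈ θ | p.1 ∈ x}, sep_subset _ _, ?_, ?_, ?_⟩
  · ext ⟨c, d⟩
    simp only [mem_insert_iff, Prod.mk.injEq, mem_ofPred_eq]
    constructor
    · intro hp
      obtain rfl | hc : c ∈ insert a x := hx ▸ ⟨d, hp⟩
      · exact Or.inl ⟨rfl, h.right_unique hp hb⟩
      · exact Or.inr ⟨hp, hc⟩
    · rintro (⟨rfl, rfl⟩ | h)
      · exact hb
      · exact h.1
  · ext c
    constructor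
    · rintro ⟨d, h1, h2⟩
      exact h2
    · intro hc
      obtain ⟨d, hd⟩ : c ∈ θ.dom := hx ▸ mem_insert_of_mem a hc
      exact ⟨d, hd, hc⟩
  · rintro ⟨c, h1, h2⟩
    obtain rfl := h.left_unique h1 hb
    exact ha h2

/-! #### Components of relations on a sum -/

/-- The component on `α` of a relation on `α ⊕ β`. -/
def inlRel (χ : SetRel (α ⊕ β) (α ⊕ β)) : SetRel α α := {p | (Sum.inl p.1, Sum.inl p.2) ∈ χ}

/-- The component on `β` of a relation on `α ⊕ β`. -/
def inrRel (χ : SetRel (α ⊕ β) (α ⊕ β)) : SetRel β β := {p | (Sum.inr p.1, Sum.inr p.2) ∈ χ}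

@[simp] theorem mem_inlRel {χ : SetRel (α ⊕ β) (α ⊕ β)} {a a' : α} :
    (a, a') ∈ inlRel χ ↔ (Sum.inl a, Sum.inl a') ∈ χ := Iff.rfl

@[simp] theorem mem_inrRel {χ : SetRel (α ⊕ β) (α ⊕ β)} {b b' : β} :
    (b, b') ∈ inrRel χ ↔ (Sum.inr b, Sum.inr b') ∈ χ := Iff.rfl

@[simp] theorem inlRel_parRel (θ : SetRel α α) (ψ : SetRel β β) :
    inlRel (parRel θ ψ) = θ := by
  ext ⟨a, b⟩; simp

@[simp] theorem inrRel_parRel (θ : SetRel α α) (ψ : SetRel β β) :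
    inrRel (parRel θ ψ) = ψ := by
  ext ⟨a, b⟩; simp

theorem parRel_comp (θ θ' : SetRel α α) (ψ ψ' : SetRel β β) :
    parRel θ ψ ○ parRel θ' ψ' = parRel (θ ○ θ') (ψ ○ ψ') := by
  ext ⟨a | a, b | b⟩ <;> simp [SetRel.comp]

theorem parRel_insert_inl (a a' : α) (θ : SetRel α α) (ψ : SetRel β β) :
    parRel (insert (a, a') θ) ψ = insert (Sum.inl a, Sum.inl a') (parRel θ ψ) := by
  ext ⟨c | c, d | d⟩ <;> simp

theorem parRel_insert_inr (b b' : β) (θ : SetRel α α) (ψ : SetRel β β) :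
    parRel θ (insert (b, b') ψ) = insert (Sum.inr b, Sum.inr b') (parRel θ ψ) := by
  ext ⟨c | c, d | d⟩ <;> simp

theorem inlRel_insert_inl (a a' : α) (χ : SetRel (α ⊕ β) (α ⊕ β)) :
    inlRel (insert (Sum.inl a, Sum.inl a') χ) = insert (a, a') (inlRel χ) := by
  ext ⟨c, d⟩; simp

/-- No condition falls on `q`: a pair starting in `β` never contributes to the component on `α`. -/
theorem inlRel_insert_inr (b : β) (q : α ⊕ β) (χ : SetRel (α ⊕ β) (α ⊕ β)) :
    inlRel (insert (Sum.inr b, q) χ) = inlRel χ := by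
  ext ⟨c, d⟩; simp

theorem inrRel_insert_inr (b b' : β) (χ : SetRel (α ⊕ β) (α ⊕ β)) :
    inrRel (insert (Sum.inr b, Sum.inr b') χ) = insert (b, b') (inrRel χ) := by
  ext ⟨c, d⟩; simp

theorem inrRel_insert_inl (a : α) (q : α ⊕ β) (χ : SetRel (α ⊕ β) (α ⊕ β)) :
    inrRel (insert (Sum.inl a, q) χ) = inrRel χ := by
  ext ⟨c, d⟩; simp

/-! ### Components of bijections in a parallel family -/

section ParFamily

variable {F : Set (SetRel α α)} {G : Set (SetRel β β)} {χ : SetRel (α ⊕ β) (α ⊕ β)}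

theorem parRel_inlRel_inrRel (h : χ ∈ parFamily F G) : parRel (inlRel χ) (inrRel χ) = χ := by
  obtain ⟨θ, -, ψ, -, rfl⟩ := h
  simp

theorem inlRel_mem (h : χ ∈ parFamily F G) : inlRel χ ∈ F := by
  obtain ⟨θ, hθ, ψ, -, rfl⟩ := h
  simpa using hθ

theorem inrRel_mem (h : χ ∈ parFamily F G) : inrRel χ ∈ G := by
  obtain ⟨θ, -, ψ, hψ, rfl⟩ := h
  simpa using hψ

theorem exists_eq_inl_of_mem (h : χ ∈ parFamily F G) {a : α} {q : α ⊕ β}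
    (hq : (Sum.inl a, q) ∈ χ) : ∃ a', q = Sum.inl a' := by
  obtain ⟨θ, -, ψ, -, rfl⟩ := h
  cases q with
  | inl a' => exact ⟨a', rfl⟩
  | inr b => simp at hq

theorem exists_eq_inr_of_mem (h : χ ∈ parFamily F G) {b : β} {q : α ⊕ β}
    (hq : (Sum.inr b, q) ∈ χ) : ∃ b', q = Sum.inr b' := by
  obtain ⟨θ, -, ψ, -, rfl⟩ := h
  cases q with
  | inl a => simp at hq
  | inr b' => exact ⟨b', rfl⟩

theorem dom_inlRel (h : χ ∈ parFamily F G) : (inlRel χ).dom = Sum.inl ⁻¹' χ.dom := by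
  obtain ⟨θ, -, ψ, -, rfl⟩ := h
  rw [dom_parRel_inl, inlRel_parRel]

theorem dom_inrRel (h : χ ∈ parFamily F G) : (inrRel χ).dom = Sum.inr ⁻¹' χ.dom := by
  obtain ⟨θ, -, ψ, -, rfl⟩ := h
  rw [dom_parRel_inr, inrRel_parRel]

theorem cod_inlRel (h : χ ∈ parFamily F G) : (inlRel χ).cod = Sum.inl ⁻¹' χ.cod := by
  obtain ⟨θ, -, ψ, -, rfl⟩ := h
  rw [cod_parRel_inl, inlRel_parRel]

theorem cod_inrRel (h : χ ∈ parFamily F G) : (inrRel χ).cod = Sum.inr ⁻¹' χ.cod := by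
  obtain ⟨θ, -, ψ, -, rfl⟩ := h
  rw [cod_parRel_inr, inrRel_parRel]

theorem inlRel_comp {F' : Set (SetRel α α)} {G' : Set (SetRel β β)}
    {χ' : SetRel (α ⊕ β) (α ⊕ β)} (h : χ ∈ parFamily F G) (h' : χ' ∈ parFamily F' G') :
    inlRel (χ ○ χ') = inlRel χ ○ inlRel χ' := by
  obtain ⟨θ, -, ψ, -, rfl⟩ := h
  obtain ⟨θ', -, ψ', -, rfl⟩ := h'
  simp [parRel_comp]

theorem inrRel_comp {F' : Set (SetRel α α)} {G' : Set (SetRel β β)}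
    {χ' : SetRel (α ⊕ β) (α ⊕ β)} (h : χ ∈ parFamily F G) (h' : χ' ∈ parFamily F' G') :
    inrRel (χ ○ χ') = inrRel χ ○ inrRel χ' := by
  obtain ⟨θ, -, ψ, -, rfl⟩ := h
  obtain ⟨θ', -, ψ', -, rfl⟩ := h'
  simp [parRel_comp]

end ParFamily

/-! #### Images of relations -/

theorem dom_mapRel (f : α → β) (θ : SetRel α α) : (mapRel f θ).dom = f '' θ.dom := by
  ext b
  constructor
  · rintro ⟨_, ⟨a, a'⟩, h, e⟩
    exact ⟨a, ⟨a', h⟩, congrArg Prod.fst e⟩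
  · rintro ⟨a, ⟨a', h⟩, rfl⟩
    exact ⟨f a', (a, a'), h, rfl⟩

theorem cod_mapRel (f : α → β) (θ : SetRel α α) : (mapRel f θ).cod = f '' θ.cod := by
  ext b
  constructor
  · rintro ⟨_, ⟨a, a'⟩, h, e⟩
    exact ⟨a', ⟨a, h⟩, congrArg Prod.snd e⟩
  · rintro ⟨a', ⟨a, h⟩, rfl⟩
    exact ⟨f a, (a, a'), h, rfl⟩

theorem mem_mapRel {f : α → β} {θ : SetRel α α} {a a' : α} (h : (a, a') ∈ θ) :
    (f a, f a') ∈ mapRel f θ := ⟨(a, a'), h, rfl⟩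

theorem mapRel_mono (f : α → β) {θ ψ : SetRel α α} (h : θ ⊆ ψ) : mapRel f θ ⊆ mapRel f ψ :=
  image_mono h

theorem mapRel_insert (f : α → β) (a a' : α) (θ : SetRel α α) :
    mapRel f (insert (a, a') θ) = insert (f a, f a') (mapRel f θ) := image_insert_eq

theorem mapRel_inv (f : α → β) (θ : SetRel α α) : mapRel f θ.inv = (mapRel f θ).inv := by
  ext ⟨b, b'⟩
  constructor
  · rintro ⟨⟨a, a'⟩, h, e⟩
    exact ⟨(a', a), h, congrArg Prod.swap e⟩
  · rintro ⟨⟨a, a'⟩, h, e⟩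
    exact ⟨(a', a), h, congrArg Prod.swap e⟩

/-- Injectivity of `f` on the middle set is what makes composable pairs of images come from
composable pairs. -/
theorem mapRel_comp (f : α → β) {θ ψ : SetRel α α} (h : θ.cod = ψ.dom) (hf : InjOn f θ.cod) :
    mapRel f (θ ○ ψ) = mapRel f θ ○ mapRel f ψ := by
  ext ⟨b, b'⟩
  constructor
  · rintro ⟨⟨a, a'⟩, ⟨c, h1, h2⟩, e⟩
    rw [← e]
    exact ⟨f c, mem_mapRel h1, mem_mapRel h2⟩
  · rintro ⟨c, ⟨⟨a, d⟩, h1, e1⟩, ⟨⟨d', a'⟩, h2, e2⟩⟩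
    simp only [Prod.map_apply, Prod.mk.injEq] at e1 e2
    obtain rfl : d = d' := hf ⟨a, h1⟩ (h ▸ ⟨a', h2⟩) (e1.2.trans e2.1.symm)
    exact ⟨(a, a'), ⟨d, h1, h2⟩, Prod.ext e1.1 e2.2⟩

theorem mapRel_idOn (f : α → β) (x : Set α) : mapRel f (idOn x) = idOn (f '' x) := by
  ext ⟨b, b'⟩
  constructor
  · rintro ⟨⟨a, a'⟩, ⟨h, e'⟩, e⟩
    obtain rfl : a = a' := e'
    simp only [Prod.map_apply, Prod.mk.injEq] at e
    exact ⟨⟨a, h, e.1⟩, e.1.symm.trans e.2⟩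
  · rintro ⟨⟨a, h, e⟩, e'⟩
    obtain rfl : b = b' := e'
    exact ⟨(a, a), ⟨h, rfl⟩, Prod.ext e e⟩

end Relations

/-! ### Isomorphism families -/

namespace EventStructure

variable {E : EventStructure.{u}}

theorem IsConfig.finite {x : Set E.Event} (h : E.IsConfig x) : x.Finite := E.con_finite x h.1

theorem isConfig_empty : E.IsConfig ∅ := ⟨E.con_empty, by simp⟩

/-- A lower subset of a configuration is a configuration. -/
theorem IsConfig.of_subset {x y : Set E.Event} (h : E.IsConfig x) (hy : y ⊆ x)
    (hl : ∀ e ∈ y, ∀ e' ≤ e, e' ∈ y) : E.IsConfig y :=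
  ⟨E.con_subset x h.1 y hy, hl⟩

theorem IsConfig.causes {x : Set E.Event} (h : E.IsConfig x) {e : E.Event} (he : e ∈ x) :
    E.IsConfig {e' | e' ≤ e} :=
  h.of_subset (fun e' he' => h.2 e he e' he') fun _ he' _ hle => le_trans hle he'

/-- Removing a maximal event from a configuration. -/
theorem IsConfig.diff_singleton {x : Set E.Event} (h : E.IsConfig x) {e : E.Event}
    (he : ∀ e' ∈ x, ¬ e < e') : E.IsConfig (x \ {e}) := by
  refine h.of_subset sdiff_subset ?_
  rintro a ⟨ha, hae⟩ b hb
  refine ⟨h.2 a ha b hb, ?_⟩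
  rintro rfl
  exact he a ha (lt_of_le_of_ne hb (Ne.symm hae))

-- A nonempty configuration is finite, so it has a maximal event, whose removal leaves a smaller
-- configuration.
@[elab_as_elim]
theorem config_induction {P : Set E.Event → Prop} (empty : P ∅)
    (insert : ∀ x e, E.IsConfig x → e ∉ x → E.IsConfig (insert e x) → P x → P (insert e x))
    (x : Set E.Event) (hx : E.IsConfig x) : P x := by
  induction hn : x.ncard using Nat.strong_induction_on generalizing x with
  | _ n ih =>
    obtain rfl | hne := x.eq_empty_or_nonempty
    · exact empty
    · obtain ⟨e, he⟩ := hx.finite.exists_maximal hne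
      have hc := hx.diff_singleton (e := e) fun e' he' hlt => (he.not_gt he') hlt
      have hi : Insert.insert e (x \ {e}) = x := insert_sdiff_self_of_mem he.prop
      have := insert _ e hc (by simp) (by rwa [hi])
        (ih _ (hn ▸ ncard_sdiff_singleton_lt_of_mem he.prop hx.finite) _ hc rfl)
      rwa [hi] at this

/-- Courtesy speaks of immediate causality only. Since `t` has finitely many causes, a strict
inequality always starts with an immediate one. -/
theorem exists_covBy_le {s t : E.Event} (h : s < t) : ∃ u, s ⋖ u ∧ u ≤ t := by
  have hf : {u | s < u ∧ u ≤ t}.Finite := (E.finite_causes t).subset fun u hu => hu.2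
  obtain ⟨u, hu⟩ := hf.exists_minimal ⟨t, h, le_rfl⟩
  refine ⟨u, ⟨hu.prop.1, fun c h1 h2 => ?_⟩, hu.prop.2⟩
  exact (hu.not_lt ⟨h1, h2.le.trans hu.prop.2⟩) h2

namespace IsIsoFamily

variable {F : Set (SetRel E.Event E.Event)} (hF : E.IsIsoFamily F)
include hF

/-- A subgraph of a bijection is its restriction to the domain of the subgraph, so the restriction
axiom applies. -/
theorem mem_of_subset {θ θ' : SetRel E.Event E.Event} (hθ : θ ∈ F) (h : θ' ⊆ θ)
    (hc : E.IsConfig θ'.dom) : θ' ∈ F := by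
  have := hF.restrict θ hθ θ'.dom (SetRel.dom_mono h) hc
  convert this using 1
  ext ⟨a, b⟩
  constructor
  · intro hp
    exact ⟨h hp, b, hp⟩
  · rintro ⟨hp, c, hc⟩
    rwa [(hF.bij θ hθ).right_unique hp (h hc)]

/-- The extension axiom yields some larger bijection on `insert e θ.dom`. Being single-valued, it
agrees with `θ` away from `e`, so it is `θ` plus one pair. -/
theorem exists_insert {θ : SetRel E.Event E.Event} (hθ : θ ∈ F) {e : E.Event} (he : e ∉ θ.dom)
    (hc : E.IsConfig (insert e θ.dom)) : ∃ e', e' ∉ θ.cod ∧ insert (e, e') θ ∈ F := by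
  obtain ⟨θ', h1, h2, h3⟩ := hF.extend θ hθ _ (subset_insert _ _) hc
  obtain ⟨e', θ'', h4, h5, h6, h7⟩ := (hF.bij θ' h1).exists_eq_insert he h3
  have : θ'' = θ := by
    ext ⟨a, b⟩
    constructor
    · intro h
      obtain ⟨c, hc⟩ : a ∈ θ.dom := h6 ▸ ⟨b, h⟩
      rwa [(hF.bij θ' h1).right_unique (h4 h) (h2 hc)]
    · intro h
      obtain ⟨c, hc⟩ : a ∈ θ''.dom := h6 ▸ ⟨b, h⟩
      rwa [(hF.bij θ' h1).right_unique (h2 h) (h4 hc)]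
  subst this
  exact ⟨e', h7, h5 ▸ h1⟩

/-- Restricting `θ` to the causes of `b` gives a codomain which is a configuration containing `b'`,
hence also `a'`; so `a` is among the causes of `b`. Applied to `θ.inv`, this also shows that
symmetries preserve the order. -/
theorem le_of_le {θ : SetRel E.Event E.Event} (hθ : θ ∈ F) {a a' b b' : E.Event}
    (ha : (a, a') ∈ θ) (hb : (b, b') ∈ θ) (h : a' ≤ b') : a ≤ b := by
  have hd := hF.dom_config θ hθ
  have hs : {e | e ≤ b} ⊆ θ.dom := fun e he => hd.2 b ⟨b', hb⟩ e he
  have := hF.cod_config _ (hF.restrict θ hθ _ hs (hd.causes ⟨b', hb⟩))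
  obtain ⟨c, h1, h2⟩ := this.2 b' ⟨b, hb, le_refl b⟩ a' h
  rwa [(hF.bij θ hθ).left_unique ha h1]

theorem symBetween_symm {x y : Set E.Event} {θ : SetRel E.Event E.Event}
    (h : θ ∈ symBetween F x y) : θ.inv ∈ symBetween F y x :=
  ⟨hF.symm _ h.1, h.2.2, h.2.1⟩

theorem symBetween_trans {x y z : Set E.Event} {θ ψ : SetRel E.Event E.Event}
    (h : θ ∈ symBetween F x y) (h' : ψ ∈ symBetween F y z) : θ ○ ψ ∈ symBetween F x z := by
  have e : θ.cod = ψ.dom := h.2.2.trans h'.2.1.symm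
  exact ⟨hF.trans _ h.1 _ h'.1 e, (dom_comp_of_cod_eq_dom e).trans h.2.1,
    (cod_comp_of_cod_eq_dom e).trans h'.2.2⟩

theorem symBetween_refl {x : Set E.Event} (h : E.IsConfig x) : idOn x ∈ symBetween F x x :=
  ⟨hF.refl _ h, dom_idOn _, cod_idOn _⟩

end IsIsoFamily

end EventStructure

/-- Symmetries preserve `+`-coveredness. -/
theorem PlusCovered.of_symBetween {E : SymEventStructure.{u}} {x y : Set E.Event}
    {φ : SetRel E.Event E.Event} (h : φ ∈ symBetween E.sym x y) (hx : PlusCovered E x) :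
    PlusCovered E y := by
  obtain ⟨h0, rfl, rfl⟩ := h
  rintro s' ⟨⟨s, hs⟩, hmax⟩
  have hE := E.sym_isIsoFamily
  rw [← E.sym_pol φ h0 _ hs]
  refine hx s ⟨⟨s', hs⟩, ?_⟩
  rintro u ⟨u', hu⟩ hle
  -- Maximality is carried back along `φ`, as both `φ` and its inverse reflect the order.
  exact hE.le_of_le h0 hu hs (hmax ⟨u, hu⟩
    (hE.le_of_le (hE.symm _ h0) (show (s', s) ∈ φ.inv from hs) (show (u', u) ∈ φ.inv from hu) hle))

/-! ### Symmetries of strategies -/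

namespace Strategy

variable {G : TCG.{u}} (σ : Strategy.{u, v} G)

theorem injOn_insert {x : Set σ.S.Event} {s : σ.S.Event} (hs : s ∉ x)
    (hc : σ.S.IsConfig (insert s x)) : σ.map s ∉ σ.map '' x := by
  rintro ⟨t, ht, e⟩
  obtain rfl := σ.map_injOn _ hc (mem_insert_of_mem s ht) (mem_insert s x) e
  exact hs ht

theorem cod_config {φ : SetRel σ.S.Event σ.S.Event} (h : φ ∈ σ.S.sym) : σ.S.IsConfig φ.cod :=
  σ.S.sym_isIsoFamily.cod_config φ h

theorem mapRel_comp {φ ψ : SetRel σ.S.Event σ.S.Event} (hφ : φ ∈ σ.S.sym)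
    (h : φ.cod = ψ.dom) : mapRel σ.map (φ ○ ψ) = mapRel σ.map φ ○ mapRel σ.map ψ :=
  ThinGames.mapRel_comp _ h (σ.map_injOn _ (σ.cod_config hφ))

theorem mapRel_mem_symBetween {x y : Set σ.S.Event} {φ : SetRel σ.S.Event σ.S.Event}
    (h : φ ∈ symBetween σ.S.sym x y) :
    mapRel σ.map φ ∈ symBetween G.sym (σ.map '' x) (σ.map '' y) :=
  ⟨σ.map_sym _ h.1, by rw [dom_mapRel, h.2.1], by rw [cod_mapRel, h.2.2]⟩

/-- Maps of event structures reflect causality on configurations. -/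
theorem le_of_map_le {x : Set σ.S.Event} (hx : σ.S.IsConfig x) {s t : σ.S.Event} (hs : s ∈ x)
    (ht : t ∈ x) (h : σ.map s ≤ σ.map t) : s ≤ t := by
  -- The image of the causes of `t` is a configuration, so it contains `σ.map s`; local injectivity
  -- then places `s` among these causes.
  obtain ⟨r, hr, e⟩ := (σ.map_isConfig _ (hx.causes ht)).2 _ ⟨t, le_refl t, rfl⟩ _ h
  rwa [← σ.map_injOn x hx (hx.2 t ht r hr) hs e]

theorem lt_of_map_lt {x : Set σ.S.Event} (hx : σ.S.IsConfig x) {s t : σ.S.Event} (hs : s ∈ x)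
    (ht : t ∈ x) (h : σ.map s < σ.map t) : s < t :=
  lt_of_le_of_ne (σ.le_of_map_le hx hs ht h.le) fun e => h.ne (congrArg σ.map e)

/-- Extensions of an identity by a positive event, or by a negative event with
the same image, are identities. -/
theorem eq_of_insert_idOn {x : Set σ.S.Event} (hx : σ.S.IsConfig x) {s t : σ.S.Event} (hs : s ∉ x)
    (hc : σ.S.IsConfig (insert s x)) (h : insert (s, t) (idOn x) ∈ σ.S.sym)
    (hn : σ.S.pol s = Polarity.minus → σ.map s = σ.map t) : s = t := by
  have hd : s ∉ (idOn x).dom := by rwa [dom_idOn]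
  have hid := σ.S.sym_isIsoFamily.refl x hx
  have hid' : insert (s, s) (idOn x) ∈ σ.S.sym := by
    rw [insert_idOn]
    exact σ.S.sym_isIsoFamily.refl _ hc
  cases hp : σ.S.pol s with
  | plus => exact σ.thin _ hid s hd hp s t hid' h
  | minus =>
    have hm := σ.map_sym _ hid'
    rw [mapRel_insert] at hm
    exact (σ.sym_receptive _ hid s hd hp (by rwa [dom_idOn]) _ hm).unique ⟨hid', rfl⟩
      ⟨h, (hn hp).symm⟩

/-- A symmetry of a strategy which is positive on the game is an identity. -/
theorem eq_idOn_of_mapRel_mem_pos (x : Set σ.S.Event) (hx : σ.S.IsConfig x) :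
    ∀ φ ∈ σ.S.sym, φ.dom = x → mapRel σ.map φ ∈ G.pos → φ = idOn x := by
  refine EventStructure.config_induction (E := σ.S.toEventStructure) ?_ ?_ x hx
  · rintro φ - hd -
    exact eq_idOn_of_forall hd fun p hp => absurd (show p.1 ∈ φ.dom from ⟨p.2, hp⟩) (by simp [hd])
  · intro x s hx hs hc ih φ hφ hd hpos
    obtain ⟨t, φ', hsub, rfl, hd', -⟩ :=
      (σ.S.sym_isIsoFamily.bij φ hφ).exists_eq_insert hs hd
    have hφ' := σ.S.sym_isIsoFamily.mem_of_subset hφ hsub (by rwa [hd'])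
    obtain rfl := ih φ' hφ' hd' (G.pos_isIsoFamily.mem_of_subset hpos (mapRel_mono _ hsub)
      (by rw [dom_mapRel, hd']; exact σ.map_isConfig x hx))
    rw [← σ.eq_of_insert_idOn hx hs hc hφ, insert_idOn]
    intro hp
    rw [mapRel_insert, mapRel_idOn] at hpos
    -- For negative `s` the image extends an identity by a negative pair, so it is negative as well
    -- as positive and must fix `σ.map s`.
    refine G.eq_id_of_pos_of_neg _ hpos ?_ _ (mem_insert _ _)
    refine G.neg_extension _ (G.neg_isIsoFamily.refl _ (σ.map_isConfig x hx)) _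
      (G.pos_subset hpos) (subset_insert _ _) ?_
    rintro p (rfl | h1) h2
    · exact (σ.map_pol s).trans hp
    · exact absurd h1 h2

/-- A symmetry from the image of a configuration factors as the image of a symmetry of the
strategy, followed by a positive symmetry. -/
theorem exists_factorization (x : Set σ.S.Event) (hx : σ.S.IsConfig x) :
    ∀ g, ∀ χ ∈ symBetween G.sym (σ.map '' x) g, ∃ y, ∃ φ ∈ symBetween σ.S.sym x y,
      ∃ χ' ∈ symBetween G.pos (σ.map '' y) g, χ = mapRel σ.map φ ○ χ' := by
  refine EventStructure.config_induction (E := σ.S.toEventStructure) ?_ ?_ x hx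
  · rintro g χ ⟨h1, h2, rfl⟩
    obtain rfl : χ = ∅ := by simpa using h2
    have he := σ.S.sym_isIsoFamily.refl ∅ EventStructure.isConfig_empty
    have he' := G.pos_isIsoFamily.refl ∅ EventStructure.isConfig_empty
    refine ⟨∅, idOn ∅, ⟨he, dom_idOn _, cod_idOn _⟩, idOn ∅, ⟨he', ?_, ?_⟩, ?_⟩
    · rw [dom_idOn, image_empty]
    · rw [cod_idOn, SetRel.cod_empty]
    · rw [mapRel_idOn, image_empty, idOn_comp (dom_idOn _)]
      ext p; simp [idOn]
  · rintro x s hx hs hc ih g χ ⟨hχ, hd, rfl⟩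
    rw [image_insert_eq] at hd
    have hms := σ.injOn_insert hs hc
    obtain ⟨c, χ₀, hsub, rfl, hd₀, hcod⟩ := (G.sym_isIsoFamily.bij _ hχ).exists_eq_insert hms hd
    have hχ₀ := G.sym_isIsoFamily.mem_of_subset hχ hsub (by
      rw [hd₀]; exact σ.map_isConfig x hx)
    obtain ⟨y, φ, hφ, χ', hχ', rfl⟩ := ih _ χ₀ ⟨hχ₀, hd₀, rfl⟩
    have hmφ := σ.mapRel_mem_symBetween hφ
    have hcc : (mapRel σ.map φ).cod = χ'.dom := hmφ.2.2.trans hχ'.2.1.symm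
    have hbφ := G.sym_isIsoFamily.bij _ hmφ.1
    have hbχ := G.pos_isIsoFamily.bij _ hχ'.1
    have hsφ : s ∉ φ.dom := by rwa [hφ.2.1]
    have hcφ : σ.S.IsConfig (insert s φ.dom) := by rwa [hφ.2.1]
    -- The new pair `(σ.map s, c)` has to be routed through the image of a single event `t`, which
    -- extends both factors.
    suffices ∃ t, t ∉ y ∧ insert (s, t) φ ∈ σ.S.sym ∧ insert (σ.map t, c) χ' ∈ G.pos by
      obtain ⟨t, hty, h1, h2⟩ := this
      have hcy := σ.cod_config h1
      rw [cod_insert, hφ.2.2] at hcy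
      have hmt := σ.injOn_insert hty hcy
      refine ⟨insert t y, insert (s, t) φ, ⟨h1, ?_, ?_⟩, insert (σ.map t, c) χ', ⟨h2, ?_, ?_⟩, ?_⟩
      · rw [dom_insert, hφ.2.1]
      · rw [cod_insert, hφ.2.2]
      · rw [dom_insert, hχ'.2.1, image_insert_eq]
      · rw [cod_insert, cod_insert, hχ'.2.2]
      · rw [mapRel_insert, insert_comp_insert (by rwa [hmφ.2.2]) (by rwa [hχ'.2.1])]
    cases hp : σ.S.pol s with
    | plus =>
      obtain ⟨t, hty, ht⟩ := σ.S.sym_isIsoFamily.exists_insert hφ.1 hsφ hcφ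
      refine ⟨t, by rwa [← hφ.2.2], ht, ?_⟩
      -- For positive `s`, any extension `t` of `φ` will do: cancelling the first factor shows that
      -- the enlarged second factor is a symmetry, and it adds a positive pair to a positive
      -- symmetry.
      have e : (mapRel σ.map (insert (s, t) φ)).inv ○ insert (σ.map s, c) (mapRel σ.map φ ○ χ') =
          insert (σ.map t, c) χ' := by
        rw [mapRel_insert, inv_insert, insert_comp_insert (by rwa [SetRel.cod_inv, hmφ.2.1])
          (by rwa [hd₀]), inv_comp_eq_of_eq_comp hbφ hcc rfl]
      refine G.pos_extension _ hχ'.1 _ ?_ (subset_insert _ _) ?_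
      · rw [← e]
        refine G.sym_isIsoFamily.trans _ (G.sym_isIsoFamily.symm _ (σ.map_sym _ ht)) _ hχ ?_
        rw [SetRel.cod_inv, dom_mapRel, dom_insert, hφ.2.1, image_insert_eq, hd]
      · rintro p (rfl | h1) h2
        · exact (σ.map_pol t).trans ((σ.S.sym_pol _ ht _ (mem_insert _ _)).symm.trans hp)
        · exact absurd h1 h2
    | minus =>
      have hcg := G.sym_isIsoFamily.cod_config _ hχ
      rw [cod_insert, ← hχ'.2.2, ← SetRel.dom_inv] at hcg
      have hcd : c ∉ χ'.inv.dom := by rwa [SetRel.dom_inv, hχ'.2.2]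
      -- For negative `s` the order of choices is reversed: the positive factor is extended first,
      -- backwards from `c`, and receptivity to symmetries then lifts its endpoint `a'` to an event
      -- `t`.
      obtain ⟨a', ha', hext⟩ := G.pos_isIsoFamily.exists_insert
        (G.pos_isIsoFamily.symm _ hχ'.1) hcd hcg
      have e : SetRel.comp (insert (σ.map s, c) (mapRel σ.map φ ○ χ')) (insert (c, a') χ'.inv) =
          insert (σ.map s, a') (mapRel σ.map φ) := by
        rw [insert_comp_insert hcod hcd, ← eq_comp_inv_of_comp_eq hbχ hcc rfl]
      have hins : insert (σ.map s, a') (mapRel σ.map φ) ∈ G.sym := by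
        rw [← e]
        refine G.sym_isIsoFamily.trans _ hχ _ (G.pos_subset hext) ?_
        rw [cod_insert, dom_insert, SetRel.dom_inv, hχ'.2.2]
      obtain ⟨t, ⟨ht, rfl⟩, -⟩ := σ.sym_receptive _ hφ.1 s hsφ hp hcφ _ hins
      refine ⟨t, fun hty => ha' ?_, ht, ?_⟩
      · rw [SetRel.cod_inv, hχ'.2.1]
        exact mem_image_of_mem _ hty
      · have := G.pos_isIsoFamily.symm _ hext
        rwa [inv_insert] at this

/-- The symmetry `φ.inv ○ φ'` of the strategy has image `χ ○ χ'.inv`, which is positive, so it is an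
identity. -/
theorem factorization_unique {x y y' : Set σ.S.Event} {g : Set G.Event}
    {φ φ' : SetRel σ.S.Event σ.S.Event} {χ χ' : SetRel G.Event G.Event}
    (hφ : φ ∈ symBetween σ.S.sym x y) (hφ' : φ' ∈ symBetween σ.S.sym x y')
    (hχ : χ ∈ symBetween G.pos (σ.map '' y) g) (hχ' : χ' ∈ symBetween G.pos (σ.map '' y') g)
    (e : mapRel σ.map φ ○ χ = mapRel σ.map φ' ○ χ') : y = y' ∧ χ = χ' := by
  have hS := σ.S.sym_isIsoFamily
  have hω := hS.symBetween_trans (hS.symBetween_symm hφ) hφ'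
  have hm := σ.mapRel_mem_symBetween hφ
  have hm' := σ.mapRel_mem_symBetween hφ'
  have hmω := σ.mapRel_mem_symBetween hω
  have hbφ := G.sym_isIsoFamily.bij _ hm.1
  have e1 : mapRel σ.map (φ.inv ○ φ') ○ χ' = χ := by
    rw [σ.mapRel_comp (hS.symm _ hφ.1) (hφ.2.1.trans hφ'.2.1.symm), SetRel.comp_assoc, ← e,
      mapRel_inv, inv_comp_eq_of_eq_comp hbφ (hm.2.2.trans hχ.2.1.symm) rfl]
  have e2 := eq_comp_inv_of_comp_eq (G.pos_isIsoFamily.bij _ hχ'.1)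
    (hmω.2.2.trans hχ'.2.1.symm) e1
  have hpos : mapRel σ.map (φ.inv ○ φ') ∈ G.pos := by
    rw [e2]
    exact (G.pos_isIsoFamily.symBetween_trans hχ (G.pos_isIsoFamily.symBetween_symm hχ')).1
  have hid := σ.eq_idOn_of_mapRel_mem_pos y (hφ.2.2 ▸ σ.cod_config hφ.1) _ hω.1 hω.2.1 hpos
  obtain rfl : y = y' := by
    rw [← hω.2.2, hid, cod_idOn]
  refine ⟨rfl, ?_⟩
  rw [← e1, hid, mapRel_idOn, idOn_comp hχ'.2.1]

end Strategy

/-! ### Graphs with a pair split off, and maximal pairs of secured bijections -/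

theorem insert_inj_of_notMem_dom {α : Type u} {β : Type v} {a : α} {b c : β} {θ ψ : SetRel α β}
    (h1 : a ∉ θ.dom) (h2 : a ∉ ψ.dom)
    (e : (insert (a, b) θ : SetRel α β) = insert (a, c) ψ) : b = c ∧ θ = ψ := by
  constructor
  · have : (a, b) ∈ (insert (a, c) ψ : SetRel α β) := e ▸ mem_insert _ _
    obtain h | h := this
    · exact congrArg Prod.snd h
    · exact absurd ⟨b, h⟩ h2
  · ext ⟨p, q⟩
    constructor
    · intro h
      have : (p, q) ∈ (insert (a, c) ψ : SetRel α β) := e ▸ mem_insert_of_mem _ h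
      obtain h' | h' := this
      · obtain rfl : p = a := congrArg Prod.fst h'
        exact absurd ⟨q, h⟩ h1
      · exact h'
    · intro h
      have : (p, q) ∈ (insert (a, b) θ : SetRel α β) := e ▸ mem_insert_of_mem _ h
      obtain h' | h' := this
      · obtain rfl : p = a := congrArg Prod.fst h'
        exact absurd ⟨q, h⟩ h2
      · exact h'

/-- A nonempty finite secured bijection has a maximal element. -/
theorem Secured.exists_maximal {α : Type u} {β : Type v} [LT α] [LT β] {φ : SetRel α β}
    (h : Secured φ) (hf : φ.Finite) (hne : φ.Nonempty) : ∃ p ∈ φ, ∀ q, ¬ Before φ p q := by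
  -- The relation is the reversed causality, so that a minimal element for `r` is causally maximal.
  let r : φ → φ → Prop := fun p q => Relation.TransGen (Before φ) q.1 p.1
  have : Finite φ := hf
  have : IsTrans φ r := ⟨fun a b c h1 h2 => h2.trans h1⟩
  have : Std.Irrefl r := ⟨fun a h1 => h _ h1⟩
  have hw : WellFounded r := Finite.wellFounded_of_trans_of_irrefl r
  obtain ⟨p, -, hp⟩ := hw.has_min univ ⟨⟨_, hne.some_mem⟩, trivial⟩
  exact ⟨p, p.2, fun q hq => hp ⟨q, hq.2.1⟩ trivial (Relation.TransGen.single hq)⟩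

namespace Strategy

/-! ### The two components of a strategy -/

section Components

variable {A B : TCG.{u}} (σ : Strat.{u, v} A B)

/-- The component on `A` of the image of a symmetry. -/
abbrev symL (φ : SetRel σ.S.Event σ.S.Event) : SetRel A.Event A.Event := inlRel (mapRel σ.map φ)

/-- The component on `B` of the image of a symmetry. -/
abbrev symR (φ : SetRel σ.S.Event σ.S.Event) : SetRel B.Event B.Event := inrRel (mapRel σ.map φ)

variable {σ}

theorem left_isConfig {x : Set σ.S.Event} (hx : σ.S.IsConfig x) : A.IsConfig (σ.left x) :=
  (isConfig_par.1 (σ.map_isConfig x hx)).1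

theorem right_isConfig {x : Set σ.S.Event} (hx : σ.S.IsConfig x) : B.IsConfig (σ.right x) :=
  (isConfig_par.1 (σ.map_isConfig x hx)).2

theorem mem_left {x : Set σ.S.Event} {a : A.Event} :
    a ∈ σ.left x ↔ ∃ s ∈ x, σ.map s = Sum.inl a := Iff.rfl

theorem mem_right {x : Set σ.S.Event} {b : B.Event} :
    b ∈ σ.right x ↔ ∃ s ∈ x, σ.map s = Sum.inr b := Iff.rfl

theorem left_insert_inl {x : Set σ.S.Event} {s : σ.S.Event} {a : A.Event}
    (h : σ.map s = Sum.inl a) : σ.left (insert s x) = insert a (σ.left x) := by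
  ext c
  simp [mem_left, h, eq_comm]

theorem left_insert_inr {x : Set σ.S.Event} {s : σ.S.Event} {b : B.Event}
    (h : σ.map s = Sum.inr b) : σ.left (insert s x) = σ.left x := by
  ext c
  simp [mem_left, h]

theorem right_insert_inr {x : Set σ.S.Event} {s : σ.S.Event} {b : B.Event}
    (h : σ.map s = Sum.inr b) : σ.right (insert s x) = insert b (σ.right x) := by
  ext c
  simp [mem_right, h, eq_comm]

theorem right_insert_inl {x : Set σ.S.Event} {s : σ.S.Event} {a : A.Event}
    (h : σ.map s = Sum.inl a) : σ.right (insert s x) = σ.right x := by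
  ext c
  simp [mem_right, h]

theorem notMem_left {x : Set σ.S.Event} {s : σ.S.Event} (hs : s ∉ x)
    (hc : σ.S.IsConfig (insert s x)) {a : A.Event} (h : σ.map s = Sum.inl a) : a ∉ σ.left x :=
  fun ha => σ.injOn_insert hs hc (by rw [h]; exact ha)

theorem notMem_right {x : Set σ.S.Event} {s : σ.S.Event} (hs : s ∉ x)
    (hc : σ.S.IsConfig (insert s x)) {b : B.Event} (h : σ.map s = Sum.inr b) : b ∉ σ.right x :=
  fun hb => σ.injOn_insert hs hc (by rw [h]; exact hb)

theorem pol_eq_of_map_eq_inl {s : σ.S.Event} {a : A.Event} (h : σ.map s = Sum.inl a) :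
    σ.S.pol s = (A.pol a).flip := by
  rw [← σ.map_pol, h]
  rfl

theorem pol_eq_of_map_eq_inr {s : σ.S.Event} {b : B.Event} (h : σ.map s = Sum.inr b) :
    σ.S.pol s = B.pol b := by
  rw [← σ.map_pol, h]
  rfl

theorem symL_mem {x y : Set σ.S.Event} {φ : SetRel σ.S.Event σ.S.Event}
    (h : φ ∈ symBetween σ.S.sym x y) : σ.symL φ ∈ symBetween A.sym (σ.left x) (σ.left y) := by
  obtain ⟨h1, h2, h3⟩ := σ.mapRel_mem_symBetween h
  exact ⟨inlRel_mem h1, by rw [dom_inlRel h1, h2]; rfl, by rw [cod_inlRel h1, h3]; rfl⟩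

theorem symR_mem {x y : Set σ.S.Event} {φ : SetRel σ.S.Event σ.S.Event}
    (h : φ ∈ symBetween σ.S.sym x y) : σ.symR φ ∈ symBetween B.sym (σ.right x) (σ.right y) := by
  obtain ⟨h1, h2, h3⟩ := σ.mapRel_mem_symBetween h
  exact ⟨inrRel_mem h1, by rw [dom_inrRel h1, h2]; rfl, by rw [cod_inrRel h1, h3]; rfl⟩

theorem symL_mono {φ ψ : SetRel σ.S.Event σ.S.Event} (h : φ ⊆ ψ) : σ.symL φ ⊆ σ.symL ψ :=
  fun _ hp => mapRel_mono σ.map h hp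

theorem symR_mono {φ ψ : SetRel σ.S.Event σ.S.Event} (h : φ ⊆ ψ) : σ.symR φ ⊆ σ.symR ψ :=
  fun _ hp => mapRel_mono σ.map h hp

theorem dom_symL {φ : SetRel σ.S.Event σ.S.Event} (h : φ ∈ σ.S.sym) :
    (σ.symL φ).dom = σ.left φ.dom := (symL_mem ⟨h, rfl, rfl⟩).2.1

theorem dom_symR {φ : SetRel σ.S.Event σ.S.Event} (h : φ ∈ σ.S.sym) :
    (σ.symR φ).dom = σ.right φ.dom := (symR_mem ⟨h, rfl, rfl⟩).2.1

theorem mapRel_eq_parRel {φ : SetRel σ.S.Event σ.S.Event} (h : φ ∈ σ.S.sym) :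
    mapRel σ.map φ = parRel (σ.symL φ) (σ.symR φ) := (parRel_inlRel_inrRel (σ.map_sym _ h)).symm

theorem symL_inv (φ : SetRel σ.S.Event σ.S.Event) : σ.symL φ.inv = (σ.symL φ).inv := by
  rw [symL, mapRel_inv]; rfl

theorem symR_inv (φ : SetRel σ.S.Event σ.S.Event) : σ.symR φ.inv = (σ.symR φ).inv := by
  rw [symR, mapRel_inv]; rfl

theorem symL_comp {x y z : Set σ.S.Event} {φ ψ : SetRel σ.S.Event σ.S.Event}
    (hφ : φ ∈ symBetween σ.S.sym x y) (hψ : ψ ∈ symBetween σ.S.sym y z) :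
    σ.symL (φ ○ ψ) = σ.symL φ ○ σ.symL ψ := by
  rw [symL, σ.mapRel_comp hφ.1 (hφ.2.2.trans hψ.2.1.symm)]
  exact inlRel_comp (σ.map_sym _ hφ.1) (σ.map_sym _ hψ.1)

theorem symR_comp {x y z : Set σ.S.Event} {φ ψ : SetRel σ.S.Event σ.S.Event}
    (hφ : φ ∈ symBetween σ.S.sym x y) (hψ : ψ ∈ symBetween σ.S.sym y z) :
    σ.symR (φ ○ ψ) = σ.symR φ ○ σ.symR ψ := by
  rw [symR, σ.mapRel_comp hφ.1 (hφ.2.2.trans hψ.2.1.symm)]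
  exact inrRel_comp (σ.map_sym _ hφ.1) (σ.map_sym _ hψ.1)

theorem symL_insert_inl {φ : SetRel σ.S.Event σ.S.Event} {s t : σ.S.Event} {a a' : A.Event}
    (h : σ.map s = Sum.inl a) (h' : σ.map t = Sum.inl a') :
    σ.symL (insert (s, t) φ) = insert (a, a') (σ.symL φ) := by
  rw [symL, mapRel_insert, h, h', inlRel_insert_inl]

theorem symL_insert_inr {φ : SetRel σ.S.Event σ.S.Event} {s t : σ.S.Event} {b : B.Event}
    (h : σ.map s = Sum.inr b) : σ.symL (insert (s, t) φ) = σ.symL φ := by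
  rw [symL, mapRel_insert, h, inlRel_insert_inr]

theorem symR_insert_inr {φ : SetRel σ.S.Event σ.S.Event} {s t : σ.S.Event} {b b' : B.Event}
    (h : σ.map s = Sum.inr b) (h' : σ.map t = Sum.inr b') :
    σ.symR (insert (s, t) φ) = insert (b, b') (σ.symR φ) := by
  rw [symR, mapRel_insert, h, h', inrRel_insert_inr]

theorem symR_insert_inl {φ : SetRel σ.S.Event σ.S.Event} {s t : σ.S.Event} {a : A.Event}
    (h : σ.map s = Sum.inl a) : σ.symR (insert (s, t) φ) = σ.symR φ := by
  rw [symR, mapRel_insert, h, inrRel_insert_inl]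

theorem exists_map_eq_inl {φ : SetRel σ.S.Event σ.S.Event} (hφ : φ ∈ σ.S.sym) {s t : σ.S.Event}
    (hst : (s, t) ∈ φ) {a : A.Event} (h : σ.map s = Sum.inl a) : ∃ a', σ.map t = Sum.inl a' :=
  exists_eq_inl_of_mem (σ.map_sym _ hφ) (by rw [← h]; exact mem_mapRel hst)

theorem exists_map_eq_inr {φ : SetRel σ.S.Event σ.S.Event} (hφ : φ ∈ σ.S.sym) {s t : σ.S.Event}
    (hst : (s, t) ∈ φ) {b : B.Event} (h : σ.map s = Sum.inr b) : ∃ b', σ.map t = Sum.inr b' :=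
  exists_eq_inr_of_mem (σ.map_sym _ hφ) (by rw [← h]; exact mem_mapRel hst)

/-- Receptivity to symmetries, for an event in `A`. -/
theorem exists_insert_of_inl {φ : SetRel σ.S.Event σ.S.Event} (hφ : φ ∈ σ.S.sym)
    {s : σ.S.Event} (hs : s ∉ φ.dom) (hp : σ.S.pol s = Polarity.minus)
    (hc : σ.S.IsConfig (insert s φ.dom)) {a a' : A.Event} (h : σ.map s = Sum.inl a)
    (hi : insert (a, a') (σ.symL φ) ∈ A.sym) :
    ∃ t, insert (s, t) φ ∈ σ.S.sym ∧ σ.map t = Sum.inl a' := by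
  refine (σ.sym_receptive φ hφ s hs hp hc (Sum.inl a') ?_).exists
  rw [h, mapRel_eq_parRel hφ, ← parRel_insert_inl]
  exact ⟨_, hi, _, inrRel_mem (σ.map_sym _ hφ), rfl⟩

/-- Receptivity to symmetries, for an event in `B`. -/
theorem exists_insert_of_inr {φ : SetRel σ.S.Event σ.S.Event} (hφ : φ ∈ σ.S.sym)
    {s : σ.S.Event} (hs : s ∉ φ.dom) (hp : σ.S.pol s = Polarity.minus)
    (hc : σ.S.IsConfig (insert s φ.dom)) {b b' : B.Event} (h : σ.map s = Sum.inr b)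
    (hi : insert (b, b') (σ.symR φ) ∈ B.sym) :
    ∃ t, insert (s, t) φ ∈ σ.S.sym ∧ σ.map t = Sum.inr b' := by
  refine (σ.sym_receptive φ hφ s hs hp hc (Sum.inr b') ?_).exists
  rw [h, mapRel_eq_parRel hφ, ← parRel_insert_inr]
  exact ⟨_, inlRel_mem (σ.map_sym _ hφ), _, hi, rfl⟩

/-- Symmetries that are negative on `A` extend along events in `A`. -/
theorem exists_insert_neg {φ : SetRel σ.S.Event σ.S.Event} (hφ : φ ∈ σ.S.sym)
    {s : σ.S.Event} (hs : s ∉ φ.dom) (hc : σ.S.IsConfig (insert s φ.dom)) {a : A.Event}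
    (h : σ.map s = Sum.inl a) (hn : σ.symL φ ∈ A.neg) :
    ∃ t, insert (s, t) φ ∈ σ.S.sym ∧ σ.symL (insert (s, t) φ) ∈ A.neg := by
  have hpol := pol_eq_of_map_eq_inl h
  cases hp : σ.S.pol s with
  | plus =>
    obtain ⟨t, -, ht⟩ := σ.S.sym_isIsoFamily.exists_insert hφ hs hc
    -- Polarities are reversed on `A`: an event positive in the strategy is negative in `A`, so any
    -- extension stays negative.
    refine ⟨t, ht, A.neg_extension _ hn _ (symL_mem ⟨ht, rfl, rfl⟩).1
      (symL_mono (subset_insert _ _)) ?_⟩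
    obtain ⟨a', ha'⟩ := exists_map_eq_inl ht (mem_insert _ _) h
    rw [symL_insert_inl h ha']
    rintro p (rfl | h1) h2
    · rw [hp] at hpol
      change A.pol a = _
      cases hq : A.pol a <;> simp_all [Polarity.flip]
    · exact absurd h1 h2
  | minus =>
    have hd := dom_symL hφ
    obtain ⟨a', -, ha'⟩ := A.neg_isIsoFamily.exists_insert hn (e := a)
      (by rw [hd]; exact notMem_left hs hc h)
      (by rw [hd, ← left_insert_inl h]; exact left_isConfig hc)
    obtain ⟨t, ht, hta⟩ := exists_insert_of_inl hφ hs hp hc h (A.neg_subset ha')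
    exact ⟨t, ht, by rwa [symL_insert_inl h hta]⟩

/-- Symmetries that are positive on `B` extend along events in `B`. -/
theorem exists_insert_pos {φ : SetRel σ.S.Event σ.S.Event} (hφ : φ ∈ σ.S.sym)
    {s : σ.S.Event} (hs : s ∉ φ.dom) (hc : σ.S.IsConfig (insert s φ.dom)) {b : B.Event}
    (h : σ.map s = Sum.inr b) (hn : σ.symR φ ∈ B.pos) :
    ∃ t, insert (s, t) φ ∈ σ.S.sym ∧ σ.symR (insert (s, t) φ) ∈ B.pos := by
  have hpol := pol_eq_of_map_eq_inr h
  cases hp : σ.S.pol s with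
  | plus =>
    obtain ⟨t, -, ht⟩ := σ.S.sym_isIsoFamily.exists_insert hφ hs hc
    refine ⟨t, ht, B.pos_extension _ hn _ (symR_mem ⟨ht, rfl, rfl⟩).1
      (symR_mono (subset_insert _ _)) ?_⟩
    obtain ⟨b', hb'⟩ := exists_map_eq_inr ht (mem_insert _ _) h
    rw [symR_insert_inr h hb']
    rintro p (rfl | h1) h2
    · exact hpol.symm.trans hp
    · exact absurd h1 h2
  | minus =>
    have hd := dom_symR hφ
    obtain ⟨b', -, hb'⟩ := B.pos_isIsoFamily.exists_insert hn (e := b)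
      (by rw [hd]; exact notMem_right hs hc h)
      (by rw [hd, ← right_insert_inr h]; exact right_isConfig hc)
    obtain ⟨t, ht, htb⟩ := exists_insert_of_inr hφ hs hp hc h (B.pos_subset hb')
    exact ⟨t, ht, by rwa [symR_insert_inr h htb]⟩

/-- An extension of an identity in `A` by a symmetry that is negative on `A` is an identity. -/
theorem eq_of_insert_idOn_neg {x : Set σ.S.Event} (hx : σ.S.IsConfig x) {s t : σ.S.Event}
    (hs : s ∉ x) (hc : σ.S.IsConfig (insert s x)) {a : A.Event} (h : σ.map s = Sum.inl a)
    (hst : insert (s, t) (idOn x) ∈ σ.S.sym) (hn : σ.symL (insert (s, t) (idOn x)) ∈ A.neg) :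
    s = t := by
  refine σ.eq_of_insert_idOn hx hs hc hst fun hp => ?_
  obtain ⟨a', ha'⟩ := exists_map_eq_inl hst (mem_insert _ _) h
  have hid : σ.symL (idOn x) = idOn (σ.left x) := by
    ext ⟨c, d⟩
    simp [symL, mapRel_idOn, Strategy.left]
  rw [symL_insert_inl h ha', hid] at hn
  rw [h, ha']
  -- A negative event of the strategy is positive in `A`. The symmetry on `A` thus extends an
  -- identity positively; being also negative, it is an identity.
  refine congrArg Sum.inl (A.eq_id_of_pos_of_neg _ (A.pos_extension _
    (A.pos_isIsoFamily.refl _ (left_isConfig hx)) _ (A.neg_subset hn) (subset_insert _ _) ?_) hn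
      _ (mem_insert _ _))
  rintro p (rfl | h1) h2
  · rw [pol_eq_of_map_eq_inl h] at hp
    change A.pol a = _
    cases hq : A.pol a <;> simp_all [Polarity.flip]
  · exact absurd h1 h2

/-- An extension of an identity in `B` by a symmetry that is positive on `B` is an identity. -/
theorem eq_of_insert_idOn_pos {x : Set σ.S.Event} (hx : σ.S.IsConfig x) {s t : σ.S.Event}
    (hs : s ∉ x) (hc : σ.S.IsConfig (insert s x)) {b : B.Event} (h : σ.map s = Sum.inr b)
    (hst : insert (s, t) (idOn x) ∈ σ.S.sym) (hn : σ.symR (insert (s, t) (idOn x)) ∈ B.pos) :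
    s = t := by
  refine σ.eq_of_insert_idOn hx hs hc hst fun hp => ?_
  obtain ⟨b', hb'⟩ := exists_map_eq_inr hst (mem_insert _ _) h
  have hid : σ.symR (idOn x) = idOn (σ.right x) := by
    ext ⟨c, d⟩
    simp [symR, mapRel_idOn, Strategy.right]
  rw [symR_insert_inr h hb', hid] at hn
  rw [h, hb']
  refine congrArg Sum.inr (B.eq_id_of_pos_of_neg _ hn (B.neg_extension _
    (B.neg_isIsoFamily.refl _ (right_isConfig hx)) _ (B.pos_subset hn) (subset_insert _ _) ?_)
      _ (mem_insert _ _))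
  rintro p (rfl | h1) h2
  · exact (pol_eq_of_map_eq_inr h).symm.trans hp
  · exact absurd h1 h2

end Components

end Strategy

/-! ### Synchronization -/

section Synchronization

variable {A B C : TCG.{u}} {σ : Strat.{u, v} A B} {τ : Strat.{u, w} B C}

theorem sync_finite {x : Set σ.S.Event} {y : Set τ.S.Event} (hx : σ.S.IsConfig x)
    (hy : τ.S.IsConfig y) (θ : SetRel B.Event B.Event) : (sync σ τ x y θ).Finite := by
  refine (((hx.finite.image Sum.inl).union ((Strategy.right_isConfig hy).finite.image
    Sum.inr)).prod (((Strategy.left_isConfig hx).finite.image Sum.inl).union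
      (hy.finite.image Sum.inr))).subset ?_
  rintro ⟨_, _⟩ (⟨s, a, hs, ha⟩ | ⟨s, t, b, b', hs, ht, -, -, -⟩ | ⟨t, c, ht, hc⟩)
  · exact ⟨Or.inl ⟨s, hs, rfl⟩, Or.inl ⟨a, ⟨s, hs, ha⟩, rfl⟩⟩
  · exact ⟨Or.inl ⟨s, hs, rfl⟩, Or.inr ⟨t, ht, rfl⟩⟩
  · exact ⟨Or.inr ⟨c, ⟨t, ht, hc⟩, rfl⟩, Or.inr ⟨t, ht, rfl⟩⟩

/-- Events over `A` stand alone and those over `B` have a partner through `θ`, so every causal link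
within `x` is visible in the synchronized graph. -/
theorem exists_mem_sync_inl {x : Set σ.S.Event} {y : Set τ.S.Event} {θ : SetRel B.Event B.Event}
    (hd : θ.dom = σ.right x) (hc : θ.cod = τ.left y) {s : σ.S.Event} (hs : s ∈ x) :
    ∃ q, (Sum.inl s, q) ∈ sync σ τ x y θ := by
  cases h : σ.map s with
  | inl a => exact ⟨_, SyncStep.left s a hs h⟩
  | inr b =>
    obtain ⟨b', hb⟩ : b ∈ θ.dom := hd ▸ ⟨s, hs, h⟩
    obtain ⟨t, ht, htb⟩ : b' ∈ τ.left y := hc ▸ ⟨b, hb⟩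
    exact ⟨_, SyncStep.mid s t b b' hs ht h htb hb⟩

theorem exists_mem_sync_inr {x : Set σ.S.Event} {y : Set τ.S.Event} {θ : SetRel B.Event B.Event}
    (hd : θ.dom = σ.right x) (hc : θ.cod = τ.left y) {t : τ.S.Event} (ht : t ∈ y) :
    ∃ p, (p, Sum.inr t) ∈ sync σ τ x y θ := by
  cases h : τ.map t with
  | inr c => exact ⟨_, SyncStep.right t c ht h⟩
  | inl b' =>
    obtain ⟨b, hb⟩ : b' ∈ θ.cod := hc ▸ ⟨t, ht, h⟩
    obtain ⟨s, hs, hsb⟩ : b ∈ σ.right x := hd ▸ ⟨b', hb⟩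
    exact ⟨_, SyncStep.mid s t b b' hs ht hsb h hb⟩

/-- Induction on synchronized configurations, in a causal order. -/
@[elab_as_elim]
theorem sync_induction (hστ : DoNotDeadlock σ τ)
    {P : Set σ.S.Event → Set τ.S.Event → SetRel B.Event B.Event → Prop} (empty : P ∅ ∅ ∅)
    (left : ∀ x y θ s a, σ.S.IsConfig x → τ.S.IsConfig y →
      θ ∈ symBetween B.sym (σ.right x) (τ.left y) → s ∉ x → σ.S.IsConfig (insert s x) →
      σ.map s = Sum.inl a → P x y θ → P (insert s x) y θ)
    (mid : ∀ x y θ s t b b', σ.S.IsConfig x → τ.S.IsConfig y →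
      θ ∈ symBetween B.sym (σ.right x) (τ.left y) → s ∉ x → σ.S.IsConfig (insert s x) →
      t ∉ y → τ.S.IsConfig (insert t y) → σ.map s = Sum.inr b → τ.map t = Sum.inl b' →
      insert (b, b') θ ∈ B.sym → P x y θ → P (insert s x) (insert t y) (insert (b, b') θ))
    (right : ∀ x y θ t c, σ.S.IsConfig x → τ.S.IsConfig y →
      θ ∈ symBetween B.sym (σ.right x) (τ.left y) → t ∉ y → τ.S.IsConfig (insert t y) →
      τ.map t = Sum.inr c → P x y θ → P x (insert t y) θ)
    (x : Set σ.S.Event) (y : Set τ.S.Event) (θ : SetRel B.Event B.Event)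
    (hx : σ.S.IsConfig x) (hy : τ.S.IsConfig y)
    (hθ : θ ∈ symBetween B.sym (σ.right x) (τ.left y)) : P x y θ := by
  induction hn : x.ncard + y.ncard using Nat.strong_induction_on generalizing x y θ with
  | _ n ih =>
  subst hn
  obtain hemp | hne := (sync σ τ x y θ).eq_empty_or_nonempty
  · obtain rfl : x = ∅ := by
      refine eq_empty_of_forall_notMem fun s hs => ?_
      obtain ⟨q, hq⟩ := exists_mem_sync_inl hθ.2.1 hθ.2.2 hs
      simp [hemp] at hq
    obtain rfl : y = ∅ := by
      refine eq_empty_of_forall_notMem fun t ht => ?_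
      obtain ⟨p, hp⟩ := exists_mem_sync_inr hθ.2.1 hθ.2.2 ht
      simp [hemp] at hp
    obtain rfl : θ = ∅ := by
      simpa [Strategy.right] using hθ.2.1
    exact empty
  obtain ⟨p, hp, hmax⟩ := (hστ x y hx hy θ hθ).exists_maximal (sync_finite hx hy θ) hne
  -- An event of `x` above `s` would give a pair above `p`; hence a maximal pair has maximal
  -- components, which can be removed.
  have removeS : ∀ s q, p = (Sum.inl s, q) → σ.S.IsConfig (x \ {s}) := by
    rintro s q rfl
    refine hx.diff_singleton fun s' hs' hlt => ?_
    obtain ⟨q', hq'⟩ := exists_mem_sync_inl hθ.2.1 hθ.2.2 hs'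
    exact hmax _ ⟨hp, hq', Or.inl (Sum.inl_lt_inl_iff.2 hlt)⟩
  have removeT : ∀ t q, p = (q, Sum.inr t) → τ.S.IsConfig (y \ {t}) := by
    rintro t q rfl
    refine hy.diff_singleton fun t' ht' hlt => ?_
    obtain ⟨q', hq'⟩ := exists_mem_sync_inr hθ.2.1 hθ.2.2 ht'
    exact hmax _ ⟨hp, hq', Or.inr (Sum.inr_lt_inr_iff.2 hlt)⟩
  have insS : ∀ s ∈ x, ∃ x', s ∉ x' ∧ insert s x' = x ∧ x'.ncard < x.ncard ∧ x' = x \ {s} :=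
    fun s hs => ⟨x \ {s}, by simp, insert_sdiff_self_of_mem hs,
      ncard_sdiff_singleton_lt_of_mem hs hx.finite, rfl⟩
  have insT : ∀ t ∈ y, ∃ y', t ∉ y' ∧ insert t y' = y ∧ y'.ncard < y.ncard ∧ y' = y \ {t} :=
    fun t ht => ⟨y \ {t}, by simp, insert_sdiff_self_of_mem ht,
      ncard_sdiff_singleton_lt_of_mem ht hy.finite, rfl⟩
  obtain ⟨p1, p2⟩ := p
  obtain ⟨s, a, hs, ha⟩ | ⟨s, t, b, b', hs, ht, hb, hb', hbb⟩ | ⟨t, c, ht, hc⟩ := id hp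
  · obtain ⟨x', hs', hx', hcard, he⟩ := insS s hs
    have hcx := removeS _ _ rfl
    rw [← he] at hcx
    clear removeS removeT insS insT hmax he hne
    subst hx'
    rw [Strategy.right_insert_inl ha] at hθ
    exact left _ _ _ _ _ hcx hy hθ hs' hx ha (ih _ (by omega) _ _ _ hcx hy hθ rfl)
  · obtain ⟨x', hs', hx', hcard, he⟩ := insS s hs
    obtain ⟨y', ht', hy', hcard', he'⟩ := insT t ht
    have hcx := removeS _ _ rfl
    have hcy := removeT _ _ rfl
    rw [← he] at hcx
    rw [← he'] at hcy
    clear removeS removeT insS insT hmax he he' hne hp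
    subst hx' hy'
    obtain ⟨hθ, hd, hc⟩ := hθ
    rw [Strategy.right_insert_inr hb] at hd
    rw [Strategy.left_insert_inl hb'] at hc
    have hbij := B.sym_isIsoFamily.bij _ hθ
    have hnb := Strategy.notMem_right hs' hx hb
    have hnb' := Strategy.notMem_left ht' hy hb'
    -- Removing a synchronized pair removes the corresponding pair from `θ` too.
    obtain ⟨b'', θ', hsub, rfl, hd', hc'⟩ := hbij.exists_eq_insert hnb hd
    obtain rfl : b' = b'' := hbij.right_unique hbb (mem_insert _ _)
    have hθ' : θ' ∈ symBetween B.sym (σ.right x') (τ.left y') := by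
      refine ⟨B.sym_isIsoFamily.mem_of_subset hθ hsub
        (hd' ▸ Strategy.right_isConfig hcx), hd', ?_⟩
      rw [cod_insert] at hc
      rw [← insert_sdiff_self_of_notMem hc', hc, insert_sdiff_self_of_notMem hnb']
    exact mid _ _ _ _ _ _ _ hcx hcy hθ' hs' hx ht' hy hb hb' hθ
      (ih _ (by omega) _ _ _ hcx hcy hθ' rfl)
  · obtain ⟨y', ht', hy', hcard', he'⟩ := insT t ht
    have hcy := removeT _ _ rfl
    rw [← he'] at hcy
    clear removeS removeT insS insT hmax he' hne hp
    subst hy'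
    rw [Strategy.left_insert_inr hc] at hθ
    exact right _ _ _ _ _ hx hcy hθ ht' hy hc (ih _ (by omega) _ _ _ hx hcy hθ rfl)

end Synchronization

/-! ### Existence and uniqueness of synchronizations -/

section Synchronization

variable {A B C : TCG.{u}} {σ : Strat.{u, v} A B} {τ : Strat.{u, w} B C}

/-- Configurations matching up to symmetry are symmetric to configurations that match on the nose,
by symmetries that are negative on `A` and positive on `C`. -/
theorem exists_synchronization (hστ : DoNotDeadlock σ τ) (x : Set σ.S.Event) (y : Set τ.S.Event)
    (θ : SetRel B.Event B.Event) (hx : σ.S.IsConfig x) (hy : τ.S.IsConfig y)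
    (hθ : θ ∈ symBetween B.sym (σ.right x) (τ.left y)) :
    ∃ φ ∈ σ.S.sym, ∃ ψ ∈ τ.S.sym, φ.dom = x ∧ ψ.dom = y ∧ σ.symL φ ∈ A.neg ∧
      τ.symR ψ ∈ C.pos ∧ σ.symR φ = θ ○ τ.symL ψ := by
  refine sync_induction hστ ?_ ?_ ?_ ?_ x y θ hx hy hθ
  · have e1 := σ.S.sym_isIsoFamily.refl ∅ EventStructure.isConfig_empty
    have e2 := τ.S.sym_isIsoFamily.refl ∅ EventStructure.isConfig_empty
    have e3 := A.neg_isIsoFamily.refl ∅ EventStructure.isConfig_empty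
    have e4 := C.pos_isIsoFamily.refl ∅ EventStructure.isConfig_empty
    refine ⟨_, e1, _, e2, dom_idOn _, dom_idOn _, ?_, ?_, ?_⟩
    · convert e3 using 1
      ext; simp [mapRel, inlRel, idOn]
    · convert e4 using 1
      ext; simp [mapRel, inrRel, idOn]
    · ext; simp [mapRel, inrRel, idOn]
  · rintro x y θ s a - - - hs hc ha ⟨φ, hφ, ψ, hψ, rfl, rfl, hA, hC, hB⟩
    obtain ⟨t, ht, hn⟩ := Strategy.exists_insert_neg hφ hs hc ha hA
    refine ⟨_, ht, ψ, hψ, dom_insert _ _ _, rfl, hn, hC, ?_⟩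
    rw [Strategy.symR_insert_inl ha, hB]
  · rintro x y θ s t b b' - - hθ hs hcs ht hct hb hb' hbb ⟨φ, hφ, ψ, hψ, rfl, rfl, hA, hC, hB⟩
    have hdφ := Strategy.dom_symR hφ
    have hdψ := Strategy.dom_symL hψ
    have hbφ := Strategy.notMem_right hs hcs hb
    have hbψ := Strategy.notMem_left ht hct hb'
    have hpb : B.pol b = B.pol b' := B.sym_pol _ hbb _ (mem_insert _ _)
    have hps := Strategy.pol_eq_of_map_eq_inr hb
    have hpt := Strategy.pol_eq_of_map_eq_inl hb'
    have hcomp : ∀ b₁, (insert (b, b₁) (σ.symR φ) : SetRel B.Event B.Event) =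
        SetRel.comp (insert (b, b') θ) (insert (b', b₁) (τ.symL ψ)) := by
      intro b₁
      rw [insert_comp_insert (by rwa [hθ.2.2]) (by rwa [hdψ]), hB]
    -- Both strategies must reach the same event `b₁` of `B`; the equation on `B` then extends by
    -- `hcomp`.
    suffices ∃ s' t' b₁, insert (s, s') φ ∈ σ.S.sym ∧ insert (t, t') ψ ∈ τ.S.sym ∧
        σ.map s' = Sum.inr b₁ ∧ τ.map t' = Sum.inl b₁ by
      obtain ⟨s', t', b₁, h1, h2, h3, h4⟩ := this
      refine ⟨_, h1, _, h2, dom_insert _ _ _, dom_insert _ _ _, ?_, ?_, ?_⟩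
      · rwa [Strategy.symL_insert_inr hb]
      · rwa [Strategy.symR_insert_inl hb']
      · rw [Strategy.symR_insert_inr hb h3, Strategy.symL_insert_inl hb' h4, hcomp]
    -- If `b` is positive, `σ` chooses `b₁` by the extension property and `τ`, for which the event
    -- is negative, follows by receptivity to symmetries. If `b` is negative, the roles are
    -- exchanged.
    cases hp : B.pol b with
    | plus =>
      obtain ⟨s', -, hs'⟩ := σ.S.sym_isIsoFamily.exists_insert hφ hs hcs
      obtain ⟨b₁, hb₁⟩ := Strategy.exists_map_eq_inr hs' (mem_insert _ _) hb
      have hm := (Strategy.symR_mem ⟨hs', rfl, rfl⟩).1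
      rw [Strategy.symR_insert_inr hb hb₁] at hm
      have hi : insert (b', b₁) (τ.symL ψ) ∈ B.sym := by
        have := B.sym_isIsoFamily.trans _ (B.sym_isIsoFamily.symm _ hbb) _ hm
          (by rw [SetRel.cod_inv, dom_insert, dom_insert, hθ.2.1, hdφ])
        rwa [inv_insert, insert_comp_insert (by rwa [SetRel.cod_inv, hθ.2.1]) (by rwa [hdφ]),
          inv_comp_eq_of_eq_comp (B.sym_isIsoFamily.bij _ hθ.1) (hθ.2.2.trans hdψ.symm) hB] at this
      obtain ⟨t', ht', htb⟩ := Strategy.exists_insert_of_inl hψ ht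
        (by rw [hpt, ← hpb, hp]; rfl) hct hb' hi
      exact ⟨s', t', b₁, hs', ht', hb₁, htb⟩
    | minus =>
      obtain ⟨t', -, ht'⟩ := τ.S.sym_isIsoFamily.exists_insert hψ ht hct
      obtain ⟨b₁, hb₁⟩ := Strategy.exists_map_eq_inl ht' (mem_insert _ _) hb'
      have hm := (Strategy.symL_mem ⟨ht', rfl, rfl⟩).1
      rw [Strategy.symL_insert_inl hb' hb₁] at hm
      have hi : insert (b, b₁) (σ.symR φ) ∈ B.sym := by
        rw [hcomp]
        exact B.sym_isIsoFamily.trans _ hbb _ hm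
          (by rw [cod_insert, dom_insert, hθ.2.2, hdψ])
      obtain ⟨s', hs', hsb⟩ := Strategy.exists_insert_of_inr hφ hs (hps.trans hp) hcs hb hi
      exact ⟨s', t', b₁, hs', ht', hsb, hb₁⟩
  · rintro x y θ t c - - - ht hct hc ⟨φ, hφ, ψ, hψ, rfl, rfl, hA, hC, hB⟩
    obtain ⟨t', ht', hn⟩ := Strategy.exists_insert_pos hψ ht hct hc hC
    refine ⟨φ, hφ, _, ht', rfl, dom_insert _ _ _, hA, hn, ?_⟩
    rw [Strategy.symL_insert_inr hc, hB]

/-- Interactions are thin: a symmetry of the interaction that is negative on `A` and positive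
on `C` is an identity. -/
theorem eq_idOn_of_synchronized (hστ : DoNotDeadlock σ τ) (x : Set σ.S.Event) (y : Set τ.S.Event)
    (θ : SetRel B.Event B.Event) (hx : σ.S.IsConfig x) (hy : τ.S.IsConfig y)
    (hθ : θ ∈ symBetween B.sym (σ.right x) (τ.left y)) :
    (∀ p ∈ θ, p.1 = p.2) → ∀ φ ∈ σ.S.sym, ∀ ψ ∈ τ.S.sym, φ.dom = x → ψ.dom = y →
      σ.symL φ ∈ A.neg → τ.symR ψ ∈ C.pos → σ.symR φ = τ.symL ψ →
      φ = idOn x ∧ ψ = idOn y := by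
  -- The induction ranges over all `θ`, so the condition that `θ` is an identity belongs to the
  -- motive.
  refine sync_induction hστ ?_ ?_ ?_ ?_ x y θ hx hy hθ
  · rintro - φ - ψ - hφ hψ - - -
    obtain rfl : φ = ∅ := by simpa using hφ
    obtain rfl : ψ = ∅ := by simpa using hψ
    constructor <;> (ext; simp [idOn])
  · rintro x y θ s a hx - - hs hc ha ih hid φ hφ ψ hψ hdφ hdψ hA hC hB
    obtain ⟨t, φ', hsub, rfl, hd', -⟩ :=
      (σ.S.sym_isIsoFamily.bij φ hφ).exists_eq_insert hs hdφ
    have hφ' := σ.S.sym_isIsoFamily.mem_of_subset hφ hsub (by rwa [hd'])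
    have hA' := A.neg_isIsoFamily.mem_of_subset hA (Strategy.symL_mono hsub)
      (by rw [Strategy.dom_symL hφ', hd']; exact Strategy.left_isConfig hx)
    rw [Strategy.symR_insert_inl ha] at hB
    obtain ⟨rfl, rfl⟩ := ih hid _ hφ' _ hψ hd' hdψ hA' hC hB
    rw [← Strategy.eq_of_insert_idOn_neg hx hs hc ha hφ hA, insert_idOn]
    exact ⟨rfl, rfl⟩
  · rintro x y θ s t b b' hx hy hθ hs hcs ht hct hb hb' - ih hid φ hφ ψ hψ hdφ hdψ hA hC hB
    obtain rfl : b = b' := hid _ (mem_insert _ _)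
    obtain ⟨s', φ', hsub, rfl, hd', -⟩ :=
      (σ.S.sym_isIsoFamily.bij φ hφ).exists_eq_insert hs hdφ
    have hφ' := σ.S.sym_isIsoFamily.mem_of_subset hφ hsub (by rwa [hd'])
    obtain ⟨t', ψ', hsub', rfl, hd'', -⟩ :=
      (τ.S.sym_isIsoFamily.bij ψ hψ).exists_eq_insert ht hdψ
    have hψ' := τ.S.sym_isIsoFamily.mem_of_subset hψ hsub' (by rwa [hd''])
    obtain ⟨b₁, hb₁⟩ := Strategy.exists_map_eq_inr hφ (mem_insert _ _) hb
    obtain ⟨b₂, hb₂⟩ := Strategy.exists_map_eq_inl hψ (mem_insert _ _) hb'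
    rw [Strategy.symR_insert_inr hb hb₁, Strategy.symL_insert_inl hb' hb₂] at hB
    obtain ⟨rfl, hB'⟩ := insert_inj_of_notMem_dom
      (by rw [Strategy.dom_symR hφ', hd']; exact Strategy.notMem_right hs hcs hb)
      (by rw [Strategy.dom_symL hψ', hd'']; exact Strategy.notMem_left ht hct hb') hB
    rw [Strategy.symL_insert_inr hb] at hA
    rw [Strategy.symR_insert_inl hb'] at hC
    obtain ⟨rfl, rfl⟩ := ih (fun p hp => hid p (mem_insert_of_mem _ hp)) _ hφ' _ hψ' hd' hd''
      hA hC hB'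
    have hps := Strategy.pol_eq_of_map_eq_inr hb
    have hpt := Strategy.pol_eq_of_map_eq_inl hb'
    suffices s = s' ∧ t = t' by
      obtain ⟨rfl, rfl⟩ := this
      exact ⟨insert_idOn _ _, insert_idOn _ _⟩
    -- The strategy for which the event is positive fixes it by thinness. The images in `B` then
    -- agree, so the other strategy fixes its own event by uniqueness in receptivity to symmetries.
    cases hp : B.pol b with
    | plus =>
      have e := σ.eq_of_insert_idOn hx hs hcs hφ (fun h => by simp [hps, hp] at h)
      refine ⟨e, τ.eq_of_insert_idOn hy ht hct hψ fun _ => ?_⟩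
      subst e
      rw [hb', hb₂, Sum.inr_injective (hb.symm.trans hb₁)]
    | minus =>
      have e := τ.eq_of_insert_idOn hy ht hct hψ (fun h => by simp [hpt, hp, Polarity.flip] at h)
      refine ⟨σ.eq_of_insert_idOn hx hs hcs hφ fun _ => ?_, e⟩
      subst e
      rw [hb, hb₁, Sum.inl_injective (hb'.symm.trans hb₂)]
  · rintro x y θ t c - hy - ht hct hc ih hid φ hφ ψ hψ hdφ hdψ hA hC hB
    obtain ⟨t', ψ', hsub, rfl, hd', -⟩ :=
      (τ.S.sym_isIsoFamily.bij ψ hψ).exists_eq_insert ht hdψ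
    have hψ' := τ.S.sym_isIsoFamily.mem_of_subset hψ hsub (by rwa [hd'])
    have hC' := C.pos_isIsoFamily.mem_of_subset hC (Strategy.symR_mono hsub)
      (by rw [Strategy.dom_symR hψ', hd']; exact Strategy.right_isConfig hy)
    rw [Strategy.symL_insert_inr hc] at hB
    obtain ⟨rfl, rfl⟩ := ih hid _ hφ _ hψ' hdφ hd' hA hC' hB
    rw [← Strategy.eq_of_insert_idOn_pos hy ht hct hc hψ hC, insert_idOn]
    exact ⟨rfl, rfl⟩

/-! ### Coverings of interactions -/

theorem InteractionConfig.idOn_mem (z : InteractionConfig σ τ) :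
    idOn (σ.right z.fst) ∈ symBetween B.sym (σ.right z.fst) (τ.left z.snd) := by
  have := B.sym_isIsoFamily.symBetween_refl (Strategy.right_isConfig z.fst_isConfig)
  rwa [← z.matching]

/-- A maximal pair has maximal components. In `B` these would be positive for both strategies, which
see opposite polarities there; so maximal events lie in `A` or `C`. -/
theorem InteractionConfig.plusCovered_of {z : InteractionConfig σ τ}
    (h1 : ThinGames.PlusCovered σ.S z.fst) (h2 : ThinGames.PlusCovered τ.S z.snd) :
    z.PlusCovered := by
  have hid := z.idOn_mem
  have maxS : ∀ s q, (Sum.inl s, q) ∈ z.events → s ∈ z.fst →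
      (∀ r, ¬ Relation.TransGen (Before z.events) (Sum.inl s, q) r) →
      σ.S.pol s = Polarity.plus := by
    intro s q hp hs hmax
    refine h1 s ⟨hs, fun s' hs' hle => ?_⟩
    by_contra hne
    obtain ⟨q', hq'⟩ := exists_mem_sync_inl hid.2.1 hid.2.2 hs'
    exact hmax _ (.single ⟨hp, hq', Or.inl (Sum.inl_lt_inl_iff.2 (lt_of_le_not_ge hle hne))⟩)
  have maxT : ∀ t q, (q, Sum.inr t) ∈ z.events → t ∈ z.snd →
      (∀ r, ¬ Relation.TransGen (Before z.events) (q, Sum.inr t) r) →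
      τ.S.pol t = Polarity.plus := by
    intro t q hp ht hmax
    refine h2 t ⟨ht, fun t' ht' hle => ?_⟩
    by_contra hne
    obtain ⟨q', hq'⟩ := exists_mem_sync_inr hid.2.1 hid.2.2 ht'
    exact hmax _ (.single ⟨hp, hq', Or.inr (Sum.inr_lt_inr_iff.2 (lt_of_le_not_ge hle hne))⟩)
  rintro ⟨_, _⟩ hp hmax
  obtain ⟨s, a, hs, ha⟩ | ⟨s, t, b, b', hs, ht, hb, hb', hbb⟩ | ⟨t, c, ht, hc⟩ := id hp
  · exact (Strategy.pol_eq_of_map_eq_inl ha).symm.trans (maxS _ _ hp hs hmax)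
  · have e1 := (Strategy.pol_eq_of_map_eq_inr hb).symm.trans (maxS _ _ hp hs hmax)
    have e2 := (Strategy.pol_eq_of_map_eq_inl hb').symm.trans (maxT _ _ hp ht hmax)
    obtain rfl : b = b' := hbb.2
    simp [e1, Polarity.flip] at e2
  · exact (Strategy.pol_eq_of_map_eq_inr hc).symm.trans (maxT _ _ hp ht hmax)

theorem fst_mem_of_mem_sync {x : Set σ.S.Event} {y : Set τ.S.Event} {θ : SetRel B.Event B.Event}
    {s : σ.S.Event} {q : A.Event ⊕ τ.S.Event} (h : (Sum.inl s, q) ∈ sync σ τ x y θ) : s ∈ x := by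
  obtain ⟨_, _, hs, _⟩ | ⟨_, _, _, _, hs, _⟩ := h <;> exact hs

theorem snd_mem_of_mem_sync {x : Set σ.S.Event} {y : Set τ.S.Event} {θ : SetRel B.Event B.Event}
    {t : τ.S.Event} {p : σ.S.Event ⊕ C.Event} (h : (p, Sum.inr t) ∈ sync σ τ x y θ) : t ∈ y := by
  generalize hq : (Sum.inr t : A.Event ⊕ τ.S.Event) = q at h
  obtain _ | ⟨_, _, _, _, _, ht, _⟩ | ⟨_, _, ht, _⟩ := h
  · cases hq
  · cases hq; exact ht
  · cases hq; exact ht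

/-- Immediate steps suffice to test maximality, since every causal chain begins with one. -/
theorem InteractionConfig.PlusCovered.positiveEvent {z : InteractionConfig σ τ}
    (h : z.PlusCovered) {p : (σ.S.Event ⊕ C.Event) × (A.Event ⊕ τ.S.Event)} (hp : p ∈ z.events)
    (hmax : ∀ q, ¬ Before z.events p q) : PositiveEvent p :=
  h p hp fun _ hq => by
    obtain ⟨r, hr, -⟩ := Relation.TransGen.head'_iff.1 hq
    exact hmax r hr

/-- A maximal `s` that is negative would give a maximal event of the interaction which is not
positive. Over `B`, a later event on the side of `τ` might prevent this; but there the partner of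
`s` is positive, and courtesy forces its immediate successors into `B`, hence back into events of
`σ` above `s`. -/
theorem InteractionConfig.PlusCovered.fst {z : InteractionConfig σ τ} (h : z.PlusCovered) :
    ThinGames.PlusCovered σ.S z.fst := by
  rintro s ⟨hs, hmax⟩
  have hid := z.idOn_mem
  have hmax' : ∀ s' ∈ z.fst, ¬ s < s' := fun s' hs' hlt => hlt.not_ge (hmax hs' hlt.le)
  have hleft : ∀ q ∈ z.events, ¬ Sum.inl s < q.1 := by
    rintro ⟨s' | c, q⟩ hq hlt
    · exact hmax' s' (fst_mem_of_mem_sync hq) (Sum.inl_lt_inl_iff.1 hlt)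
    · exact Sum.not_inl_lt_inr hlt
  obtain ⟨q, hq⟩ := exists_mem_sync_inl hid.2.1 hid.2.2 hs
  obtain ⟨_, a, _, ha⟩ | ⟨_, t, b, b', _, ht, hb, hb', hbb⟩ := id hq
  · rw [Strategy.pol_eq_of_map_eq_inl ha]
    refine h.positiveEvent hq ?_
    rintro ⟨q1, q2⟩ ⟨-, hr, hlt | hlt⟩
    · exact hleft _ hr hlt
    · obtain ⟨s', a', hs', ha'⟩ | _ | _ := hr
      -- A link between events of `A` is reflected by `σ.map` into a link within the configuration
      -- of `σ`.
      · exact hmax' s' hs' (σ.lt_of_map_lt z.fst_isConfig hs hs' (by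
          rw [ha, ha']; exact Sum.inl_lt_inl_iff.2 (Sum.inl_lt_inl_iff.1 hlt)))
      · exact Sum.not_inl_lt_inr hlt
      · exact Sum.not_inl_lt_inr hlt
  · obtain rfl : b = b' := hbb.2
    cases hp : B.pol b with
    | plus => rw [Strategy.pol_eq_of_map_eq_inr hb, hp]
    | minus =>
      refine (h.positiveEvent hq ?_).elim
      rintro ⟨q1, q2⟩ ⟨-, hr, hlt | hlt⟩
      · exact hleft _ hr hlt
      · cases q2 with
        | inl a => exact Sum.not_inr_lt_inl hlt
        | inr t' =>
          obtain ⟨u, hu, hle⟩ := EventStructure.exists_covBy_le (Sum.inr_lt_inr_iff.1 hlt)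
          have hut := z.snd_isConfig.2 t' (snd_mem_of_mem_sync hr) u hle
          -- The event is negative in `B`, hence positive for `τ`, and courtesy turns `t ⋖ u` into
          -- causality in `B^⊥ ∥ C`, where `B` and `C` are incomparable.
          have hlt' := (τ.courteous t u hu (Or.inl (by
            rw [Strategy.pol_eq_of_map_eq_inl hb', hp]; rfl))).lt
          rw [hb'] at hlt'
          cases hu' : τ.map u with
          | inr c =>
            rw [hu'] at hlt'
            exact Sum.not_inl_lt_inr hlt'
          | inl b₁ =>
            obtain ⟨s', hs', hsb⟩ : b₁ ∈ σ.right z.fst := z.matching ▸ ⟨u, hut, hu'⟩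
            rw [hu'] at hlt'
            exact hmax' s' hs' (σ.lt_of_map_lt z.fst_isConfig hs hs' (by
              rw [hb, hsb]; exact Sum.inr_lt_inr_iff.2 (Sum.inl_lt_inl_iff.1 hlt')))

theorem InteractionConfig.PlusCovered.snd {z : InteractionConfig σ τ} (h : z.PlusCovered) :
    ThinGames.PlusCovered τ.S z.snd := by
  rintro t ⟨ht, hmax⟩
  have hid := z.idOn_mem
  have hmax' : ∀ t' ∈ z.snd, ¬ t < t' := fun t' ht' hlt => hlt.not_ge (hmax ht' hlt.le)
  have hright : ∀ q ∈ z.events, ¬ Sum.inr t < q.2 := by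
    rintro ⟨q, a | t'⟩ hq hlt
    · exact Sum.not_inr_lt_inl hlt
    · exact hmax' t' (snd_mem_of_mem_sync hq) (Sum.inr_lt_inr_iff.1 hlt)
  cases hm : τ.map t with
  | inr c =>
    rw [Strategy.pol_eq_of_map_eq_inr hm]
    refine h.positiveEvent (p := (Sum.inr c, Sum.inr t)) (SyncStep.right t c ht hm) ?_
    rintro ⟨q1, q2⟩ ⟨-, hr, hlt | hlt⟩
    · obtain _ | _ | ⟨t', c', ht', hc'⟩ := hr
      · exact Sum.not_inr_lt_inl hlt
      · exact Sum.not_inr_lt_inl hlt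
      · exact hmax' t' ht' (τ.lt_of_map_lt z.snd_isConfig ht ht' (by
          rw [hm, hc']; exact Sum.inr_lt_inr_iff.2 (Sum.inr_lt_inr_iff.1 hlt)))
    · exact hright _ hr hlt
  | inl b =>
    obtain ⟨s, hs, hb⟩ : b ∈ σ.right z.fst := z.matching ▸ ⟨t, ht, hm⟩
    cases hp : B.pol b with
    | minus => rw [Strategy.pol_eq_of_map_eq_inl hm, hp]; rfl
    | plus =>
      refine (h.positiveEvent (p := (Sum.inl s, Sum.inr t))
        (SyncStep.mid s t b b hs ht hb hm ⟨⟨s, hs, hb⟩, rfl⟩) ?_).elim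
      rintro ⟨q1, q2⟩ ⟨-, hr, hlt | hlt⟩
      · cases q1 with
        | inr c => exact Sum.not_inl_lt_inr hlt
        | inl s' =>
          obtain ⟨u, hu, hle⟩ := EventStructure.exists_covBy_le (Sum.inl_lt_inl_iff.1 hlt)
          have hus := z.fst_isConfig.2 s' (fst_mem_of_mem_sync hr) u hle
          have hlt' := (σ.courteous s u hu (Or.inl (by
            rw [Strategy.pol_eq_of_map_eq_inr hb, hp]))).lt
          rw [hb] at hlt'
          cases hu' : σ.map u with
          | inl a =>
            rw [hu'] at hlt'
            exact Sum.not_inr_lt_inl hlt'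
          | inr b₁ =>
            obtain ⟨t', ht', htb⟩ : b₁ ∈ τ.left z.snd := z.matching ▸ ⟨u, hus, hu'⟩
            rw [hu'] at hlt'
            exact hmax' t' ht' (τ.lt_of_map_lt z.snd_isConfig ht ht' (by
              rw [hm, htb]; exact Sum.inl_lt_inl_iff.2 (Sum.inr_lt_inr_iff.1 hlt')))
      · exact hright _ hr hlt

end Synchronization

/-! ### Counting witnesses by a bijective correspondence -/

/-- Both directions of the correspondence are existence statements with uniqueness, so a relation
avoids defining either map explicitly. -/
theorem nonempty_equiv_of_rel {α : Type u} {β : Type v} (R : α → β → Prop)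
    (h1 : ∀ a, ∃ b, R a b) (h2 : ∀ b, ∃ a, R a b)
    (h3 : ∀ a b b', R a b → R a b' → b = b') (h4 : ∀ a a' b, R a b → R a' b → a = a') :
    Nonempty (α ≃ β) := by
  choose f hf using h1
  refine ⟨Equiv.ofBijective f ⟨fun a a' e => ?_, fun b => ?_⟩⟩
  · exact h4 a a' _ (hf a) (e ▸ hf a')
  · obtain ⟨a, ha⟩ := h2 b
    exact ⟨a, h3 a _ _ (hf a) ha⟩

/-- Composition with a symmetry `κ : x ≅ y` turns the symmetries from `x` to `y` into the
endosymmetries of `y`. -/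
def symBetweenEquiv {E : EventStructure.{u}} {F : Set (SetRel E.Event E.Event)}
    (hF : E.IsIsoFamily F) {x y : Set E.Event} {κ : SetRel E.Event E.Event}
    (hκ : κ ∈ symBetween F x y) : symBetween F x y ≃ symBetween F y y where
  toFun χ := ⟨κ.inv ○ χ.1, hF.symBetween_trans (hF.symBetween_symm hκ) χ.2⟩
  invFun ω := ⟨κ ○ ω.1, hF.symBetween_trans hκ ω.2⟩
  left_inv χ := Subtype.ext (by
    change κ ○ (κ.inv ○ χ.1) = χ.1
    rw [← SetRel.comp_assoc, (hF.bij _ hκ.1).comp_inv, idOn_comp (χ.2.2.1.trans hκ.2.1.symm)])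
  right_inv ω := Subtype.ext (by
    change κ.inv ○ (κ ○ ω.1) = ω.1
    rw [← SetRel.comp_assoc, (hF.bij _ hκ.1).inv_comp, idOn_comp (ω.2.2.1.trans hκ.2.2.symm)])

/-- Comparing two interactions over the same pair cancels the symmetries `ψ` of that pair. -/
theorem comp_inv_eq_of_eq_comp {α β γ δ : Type*} {θ : SetRel α β} {θ' : SetRel δ β}
    {ψ : SetRel β γ} {χ : SetRel α γ} {χ' : SetRel δ γ} (hψ : IsBij ψ) (h : θ.cod = ψ.dom)
    (e : χ = θ ○ ψ) (e' : χ' = θ' ○ ψ) : θ ○ θ'.inv = χ ○ χ'.inv := by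
  rw [e, e', SetRel.inv_comp, SetRel.comp_assoc, ← SetRel.comp_assoc ψ, hψ.comp_inv,
    ← SetRel.comp_assoc, comp_idOn h]

theorem parRel_mem_symBetween {α : Type u} {β : Type v} {x : Set (α ⊕ β)} {y : Set α} {y' : Set β}
    {F : Set (SetRel α α)} {G : Set (SetRel β β)} {θ : SetRel α α} {ψ : SetRel β β}
    (hθ : θ ∈ symBetween F (Sum.inl ⁻¹' x) y) (hψ : ψ ∈ symBetween G (Sum.inr ⁻¹' x) y') :
    parRel θ ψ ∈ symBetween (parFamily F G) x (Sum.inl '' y ∪ Sum.inr '' y') := by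
  refine ⟨⟨θ, hθ.1, ψ, hψ.1, rfl⟩, ?_, ?_⟩
  · ext (e | e)
    · exact Set.ext_iff.1 ((dom_parRel_inl θ ψ).trans hθ.2.1) e
    · exact Set.ext_iff.1 ((dom_parRel_inr θ ψ).trans hψ.2.1) e
  · ext (e | e)
    · simpa using Set.ext_iff.1 ((cod_parRel_inl θ ψ).trans hθ.2.2) e
    · simpa using Set.ext_iff.1 ((cod_parRel_inr θ ψ).trans hψ.2.2) e

section Counting

variable {A B C : TCG.{u}} {σ : Strat.{u, v} A B} {τ : Strat.{u, w} B C}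
  {a : A.Config} {b : B.Config} {c : C.Config}

/-- Witnesses of the interaction, with a symmetry from the component in `B` to `b`. -/
abbrev RigidInteractionWitness (σ : Strat.{u, v} A B) (τ : Strat.{u, w} B C)
    (a : A.Config) (b : B.Config) (c : C.Config) :=
  Σ i : SymInteractionWitness σ τ a b c, symBetween B.sym (σ.right i.config.fst) b.1

/-- A pair of witnesses is related to a witness of the interaction by symmetries of
the two strategies that commute with all symmetries to `a`, `b` and `c`. -/
def Synchronizes (p : SymWitness σ a b × SymWitness τ b c)
    (i : RigidInteractionWitness σ τ a b c) : Prop :=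
  ∃ φ ∈ symBetween σ.S.sym i.1.config.fst p.1.config,
    ∃ ψ ∈ symBetween τ.S.sym i.1.config.snd p.2.config,
      i.1.symA = σ.symL φ ○ p.1.symA ∧ i.2.1 = σ.symR φ ○ p.1.symB ∧
        i.2.1 = τ.symL ψ ○ p.2.symA ∧ i.1.symC = τ.symR ψ ○ p.2.symB

theorem exists_interaction_synchronizes (hστ : DoNotDeadlock σ τ)
    (p : SymWitness σ a b × SymWitness τ b c) :
    ∃ i : RigidInteractionWitness σ τ a b c, Synchronizes p i := by
  obtain ⟨⟨x, hx, hpx, θA, hA, θB, hB⟩, ⟨y, hy, hpy, ψB, hB', ψC, hC⟩⟩ := p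
  have hBs : θB ∈ symBetween B.sym _ _ := ⟨B.pos_subset hB.1, hB.2⟩
  have hBs' : ψB ∈ symBetween B.sym _ _ := ⟨B.neg_subset hB'.1, hB'.2⟩
  have hsym := B.sym_isIsoFamily
  have hθ := hsym.symBetween_trans hBs (hsym.symBetween_symm hBs')
  -- The mismatch on `B` is `θB ○ ψB.inv`; the interaction is formed by the codomains of the two
  -- symmetries that absorb it.
  obtain ⟨φ, hφ, ψ, hψ, rfl, rfl, hφA, hψC, e⟩ := exists_synchronization hστ x y _ hx hy hθ
  have hφs : φ ∈ symBetween σ.S.sym _ _ := ⟨hφ, rfl, rfl⟩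
  have hψs : ψ ∈ symBetween τ.S.sym _ _ := ⟨hψ, rfl, rfl⟩
  have hφi := σ.S.sym_isIsoFamily.symBetween_symm hφs
  have hψi := τ.S.sym_isIsoFamily.symBetween_symm hψs
  have hφR := Strategy.symR_mem hφs
  have hψL := Strategy.symL_mem hψs
  have hmatch : σ.right φ.cod = τ.left ψ.cod := by
    rw [← hφR.2.2, e, cod_comp_of_cod_eq_dom (hθ.2.2.trans hψL.2.1.symm), hψL.2.2]
  have hcx := σ.cod_config hφ
  have hcy := τ.cod_config hψ
  have hid : idOn (σ.right φ.cod) ∈ symBetween B.sym (σ.right φ.cod) (τ.left ψ.cod) := by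
    have := hsym.symBetween_refl (Strategy.right_isConfig hcx)
    rwa [← hmatch]
  let z : InteractionConfig σ τ := ⟨φ.cod, ψ.cod, hcx, hcy, hmatch, hστ _ _ hcx hcy _ hid⟩
  -- Transport of `θB` along `φ` and of `ψB` along `ψ` give the same symmetry to `b`, by the choice
  -- of the mismatch.
  have hχ : (σ.symR φ).inv ○ θB ∈ symBetween B.sym (σ.right z.fst) b.1 :=
    hsym.symBetween_trans (hsym.symBetween_symm hφR) hBs
  have hzA : (σ.symL φ).inv ○ θA ∈ symBetween A.neg (σ.left z.fst) a.1 :=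
    A.neg_isIsoFamily.symBetween_trans (A.neg_isIsoFamily.symBetween_symm
      ⟨hφA, (Strategy.symL_mem hφs).2⟩) hA
  have hzC : (τ.symR ψ).inv ○ ψC ∈ symBetween C.pos (τ.right z.snd) c.1 :=
    C.pos_isIsoFamily.symBetween_trans (C.pos_isIsoFamily.symBetween_symm
      ⟨hψC, (Strategy.symR_mem hψs).2⟩) hC
  refine ⟨⟨⟨z, InteractionConfig.plusCovered_of (hpx.of_symBetween hφs) (hpy.of_symBetween hψs),
    _, hzA, ⟨_, hχ⟩, _, hzC⟩, _, hχ⟩, φ.inv, hφi, ψ.inv, hψi, ?_, ?_, ?_, ?_⟩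
  · rw [Strategy.symL_inv]
  · rw [Strategy.symR_inv]
  · change (σ.symR φ).inv ○ θB = _
    rw [Strategy.symL_inv, e, SetRel.inv_comp, SetRel.inv_comp, SetRel.inv_inv,
      SetRel.comp_assoc, SetRel.comp_assoc, (hsym.bij _ hBs.1).inv_comp,
      comp_idOn (hBs'.2.2.trans hBs.2.2.symm)]
  · rw [Strategy.symR_inv]

theorem exists_pair_synchronizes (i : RigidInteractionWitness σ τ a b c) :
    ∃ p : SymWitness σ a b × SymWitness τ b c, Synchronizes p i := by
  obtain ⟨⟨z, hz, θA, hA, -, θC, hC⟩, χ, hχ⟩ := i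
  have hχ' : χ ∈ symBetween B.sym (τ.left z.snd) b.1 := by rwa [← z.matching]
  have hAs : θA ∈ symBetween A.sym _ _ := ⟨A.neg_subset hA.1, hA.2⟩
  have hCs : θC ∈ symBetween C.sym _ _ := ⟨C.pos_subset hC.1, hC.2⟩
  -- The same `χ` is factored twice: with `θA` along `σ`, leaving a positive symmetry on `B`, and
  -- with `θC` along `τ`, leaving a negative one.
  obtain ⟨x, φ, hφ, χ₁, ⟨⟨θA', h1, θB, h2, rfl⟩, hd, hc⟩, e⟩ :=
    σ.exists_factorization z.fst z.fst_isConfig _ _ (parRel_mem_symBetween hAs hχ)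
  obtain ⟨y, ψ, hψ, χ₂, ⟨⟨ψB, h3, θC', h4, rfl⟩, hd', hc'⟩, e'⟩ :=
    τ.exists_factorization z.snd z.snd_isConfig _ _ (parRel_mem_symBetween hχ' hCs)
  rw [Strategy.mapRel_eq_parRel hφ.1, parRel_comp] at e
  rw [Strategy.mapRel_eq_parRel hψ.1, parRel_comp] at e'
  refine ⟨⟨⟨x, hφ.2.2 ▸ σ.cod_config hφ.1, hz.fst.of_symBetween hφ, θA', ⟨h1, ?_, ?_⟩,
      θB, ⟨h2, ?_, ?_⟩⟩, ⟨y, hψ.2.2 ▸ τ.cod_config hψ.1, hz.snd.of_symBetween hψ,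
      ψB, ⟨h3, ?_, ?_⟩, θC', ⟨h4, ?_, ?_⟩⟩⟩, φ, hφ, ψ, hψ, ?_, ?_, ?_, ?_⟩
  · rw [← dom_parRel_inl θA' θB, hd]; rfl
  · rw [← cod_parRel_inl θA' θB, hc]; ext; simp
  · rw [← dom_parRel_inr θA' θB, hd]; rfl
  · rw [← cod_parRel_inr θA' θB, hc]; ext; simp
  · rw [← dom_parRel_inl ψB θC', hd']; rfl
  · rw [← cod_parRel_inl ψB θC', hc']; ext; simp
  · rw [← dom_parRel_inr ψB θC', hd']; rfl
  · rw [← cod_parRel_inr ψB θC', hc']; ext; simp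
  · simpa using congrArg inlRel e
  · simpa using congrArg inrRel e
  · simpa using congrArg inlRel e'
  · simpa using congrArg inrRel e'

/-- The composites `φ ○ φ'.inv` and `ψ ○ ψ'.inv` agree on `B`, where both equal `χ ○ χ'.inv`. They
are negative on `A` and positive on `C`, as the data of both interactions are, so thinness of
interactions makes them identities. -/
theorem Synchronizes.interaction_unique (hστ : DoNotDeadlock σ τ)
    {p : SymWitness σ a b × SymWitness τ b c} {i i' : RigidInteractionWitness σ τ a b c}
    (h : Synchronizes p i) (h' : Synchronizes p i') : i = i' := by
  obtain ⟨⟨x, hx, hpx, θA, hA, θB, hB⟩, ⟨y, hy, hpy, ψB, hB', ψC, hC⟩⟩ := p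
  obtain ⟨⟨z, hz, zA, hzA, hzB, zC, hzC⟩, χ, hχ⟩ := i
  obtain ⟨⟨z', hz', zA', hzA', hzB', zC', hzC'⟩, χ', hχ'⟩ := i'
  obtain ⟨φ, hφ, ψ, hψ, e1, e2, e3, e4⟩ := h
  obtain ⟨φ', hφ', ψ', hψ', e1', e2', e3', e4'⟩ := h'
  dsimp only at *
  have hφi := σ.S.sym_isIsoFamily.symBetween_symm hφ'
  have hψi := τ.S.sym_isIsoFamily.symBetween_symm hψ'
  have hω := σ.S.sym_isIsoFamily.symBetween_trans hφ hφi
  have hκ := τ.S.sym_isIsoFamily.symBetween_trans hψ hψi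
  have eA : σ.symL (φ ○ φ'.inv) = zA ○ zA'.inv := by
    rw [Strategy.symL_comp hφ hφi, Strategy.symL_inv]
    exact comp_inv_eq_of_eq_comp (A.neg_isIsoFamily.bij _ hA.1)
      ((Strategy.symL_mem hφ).2.2.trans hA.2.1.symm) e1 e1'
  have eB : σ.symR (φ ○ φ'.inv) = χ ○ χ'.inv := by
    rw [Strategy.symR_comp hφ hφi, Strategy.symR_inv]
    exact comp_inv_eq_of_eq_comp (B.pos_isIsoFamily.bij _ hB.1)
      ((Strategy.symR_mem hφ).2.2.trans hB.2.1.symm) e2 e2'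
  have eB' : τ.symL (ψ ○ ψ'.inv) = χ ○ χ'.inv := by
    rw [Strategy.symL_comp hψ hψi, Strategy.symL_inv]
    exact comp_inv_eq_of_eq_comp (B.neg_isIsoFamily.bij _ hB'.1)
      ((Strategy.symL_mem hψ).2.2.trans hB'.2.1.symm) e3 e3'
  have eC : τ.symR (ψ ○ ψ'.inv) = zC ○ zC'.inv := by
    rw [Strategy.symR_comp hψ hψi, Strategy.symR_inv]
    exact comp_inv_eq_of_eq_comp (C.pos_isIsoFamily.bij _ hC.1)
      ((Strategy.symR_mem hψ).2.2.trans hC.2.1.symm) e4 e4'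
  obtain ⟨hid, hid'⟩ := eq_idOn_of_synchronized hστ _ _ _ z.fst_isConfig z.snd_isConfig z.idOn_mem
    (fun p hp => hp.2) _ hω.1 _ hκ.1 hω.2.1 hκ.2.1
    (by
      rw [eA]
      exact (A.neg_isIsoFamily.symBetween_trans hzA (A.neg_isIsoFamily.symBetween_symm hzA')).1)
    (by
      rw [eC]
      exact (C.pos_isIsoFamily.symBetween_trans hzC (C.pos_isIsoFamily.symBetween_symm hzC')).1)
    (eB.trans eB'.symm)
  have hfst : z.fst = z'.fst := by rw [← hω.2.2, hid, cod_idOn]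
  have hsnd : z.snd = z'.snd := by rw [← hκ.2.2, hid', cod_idOn]
  -- Composing the identity `φ ○ φ'.inv` with `φ'` cancels the inverse.
  have hφφ : φ = φ' := by
    have := congrArg (· ○ φ') hid
    simpa [SetRel.comp_assoc, (σ.S.sym_isIsoFamily.bij _ hφ'.1).inv_comp,
      comp_idOn (hφ.2.2.trans hφ'.2.2.symm), idOn_comp (hφ'.2.1.trans hfst.symm)] using this
  have hψψ : ψ = ψ' := by
    have := congrArg (· ○ ψ') hid'
    simpa [SetRel.comp_assoc, (τ.S.sym_isIsoFamily.bij _ hψ'.1).inv_comp,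
      comp_idOn (hψ.2.2.trans hψ'.2.2.symm), idOn_comp (hψ'.2.1.trans hsnd.symm)] using this
  subst hφφ hψψ
  obtain rfl := e1.trans e1'.symm
  obtain rfl := e2.trans e2'.symm
  obtain rfl := e4.trans e4'.symm
  obtain rfl : z = z' := by
    cases z
    cases z'
    cases hfst
    cases hsnd
    rfl
  rfl

/-- Both pairs give factorizations of the same symmetries, `symA ∥ χ` along `σ` and `χ ∥ symC` along
`τ`, whose positive parts are unique. -/
theorem Synchronizes.pair_unique {p p' : SymWitness σ a b × SymWitness τ b c}
    {i : RigidInteractionWitness σ τ a b c} (h : Synchronizes p i) (h' : Synchronizes p' i) :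
    p = p' := by
  obtain ⟨⟨x, hx, hpx, θA, hA, θB, hB⟩, ⟨y, hy, hpy, ψB, hB', ψC, hC⟩⟩ := p
  obtain ⟨⟨x', hx', hpx', θA', hA', θB', hBB⟩, ⟨y', hy', hpy', ψB', hBB', ψC', hC'⟩⟩ := p'
  obtain ⟨φ, hφ, ψ, hψ, e1, e2, e3, e4⟩ := h
  obtain ⟨φ', hφ', ψ', hψ', e1', e2', e3', e4'⟩ := h'
  dsimp only at *
  obtain ⟨rfl, hσ⟩ := σ.factorization_unique hφ hφ' (parRel_mem_symBetween hA hB) (parRel_mem_symBetween hA' hBB) (by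
    rw [Strategy.mapRel_eq_parRel hφ.1, Strategy.mapRel_eq_parRel hφ'.1, parRel_comp, parRel_comp,
      ← e1, ← e2, ← e1', ← e2'])
  obtain ⟨rfl, hτ⟩ := τ.factorization_unique hψ hψ' (parRel_mem_symBetween hB' hC) (parRel_mem_symBetween hBB' hC') (by
    rw [Strategy.mapRel_eq_parRel hψ.1, Strategy.mapRel_eq_parRel hψ'.1, parRel_comp, parRel_comp,
      ← e3, ← e4, ← e3', ← e4'])
  obtain rfl : θA = θA' := by simpa using congrArg inlRel hσ
  obtain rfl : θB = θB' := by simpa using congrArg inrRel hσ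
  obtain rfl : ψB = ψB' := by simpa using congrArg inlRel hτ
  obtain rfl : ψC = ψC' := by simpa using congrArg inrRel hτ
  rfl

/-- Pairs of witnesses correspond to witnesses of the interaction with an endosymmetry of `b`. -/
theorem nonempty_equiv_interaction_prod (hστ : DoNotDeadlock σ τ) (a : A.Config) (b : B.Config)
    (c : C.Config) : Nonempty (SymWitness σ a b × SymWitness τ b c ≃
      SymInteractionWitness σ τ a b c × EndoSym b) := by
  obtain ⟨e⟩ := nonempty_equiv_of_rel Synchronizes
    (exists_interaction_synchronizes (a := a) (b := b) (c := c) hστ) exists_pair_synchronizes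
    (fun _ _ _ h h' => h.interaction_unique hστ h') (fun _ _ _ h h' => h.pair_unique h')
  -- Any choice of a symmetry from the component in `B` to `b` trivializes the torsor over each
  -- witness of the interaction.
  exact ⟨e.trans (Equiv.sigmaEquivProdOfEquiv fun i =>
    symBetweenEquiv B.sym_isIsoFamily i.symB_nonempty.some_mem)⟩

end Counting

end ThinGames

theorem mainTheorem2 {A B C : ThinGames.TCG.{u}}
    (ρA : A.Representatives) (ρB : B.Representatives) (ρC : C.Representatives)
    (σ : ThinGames.Strat.{u, v} A B) (τ : ThinGames.Strat.{u, w} B C)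
    (hστ : ThinGames.DoNotDeadlock σ τ)
    (xA : A.SymClass) (xB : B.SymClass) (xC : C.SymClass) :
    ENat.card (ThinGames.SymWitness σ (ρA.rep xA) (ρB.rep xB)) *
        ENat.card (ThinGames.SymWitness τ (ρB.rep xB) (ρC.rep xC)) =
      ENat.card (ThinGames.SymInteractionWitness σ τ (ρA.rep xA) (ρB.rep xB) (ρC.rep xC)) *
        ENat.card (ThinGames.EndoSym (ρB.rep xB)) := by
  obtain ⟨e⟩ := ThinGames.nonempty_equiv_interaction_prod hστ (ρA.rep xA) (ρB.rep xB) (ρC.rep xC)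
  rw [← ENat.card_prod, ← ENat.card_prod, ENat.card_congr e]
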